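/- Corollary 4.4. A map on a compact connected oriented surface is a cellular embedding of a finite connected graph; it is orientably regular if its group of orientation-preserving automorphisms is transitive on its arcs (directed edges). Maps are described here, as usual, by their arcs, the rotation permutation (sending each arc to the next arc with the same initial vertex according to the orientation) and the involution reversing the arcs; isomorphisms of maps preserve the orientation, that is, they are bijections between arcs commuting with both permutations. Let $p$ be a prime, let $q=p^e\equiv 1 \pmod 4$, and let $F_q$ be a field of order $q$. The Paley graph $P_q$ has vertex set $F_q$, with $v$ and $w$ adjacent if and only if $v-w$ is a nonzero square. For each generator $s$ of the group $S$ of nonzero squares in $F_q^*$, the Paley map $\mathcal M_q(s)$ is the embedding of $P_q$ in an oriented surface in which the neighbours of each vertex $v$ have the cyclic order $v+1, v+s, v+s^2,\ldots,v+s^{(q-3)/2}$. Then a map $\mathcal M$ is an orientably regular embedding of $P_q$ (that is, it is orientably regular and its underlying graph is isomorphic to $P_q$) if and only if $\mathcal M$ is isomorphic to $\mathcal M_q(s)$ for some generator $s$ of $S$. Moreover $e$ divides $\varphi\left(\frac{q-1}{2}\right)$, and the maps $\mathcal M_q(s)$ form exactly $\varphi\left(\frac{q-1}{2}\right)/e$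 isomorphism classes. -/

import Mathlib

universe u v

/-- A map on a compact connected oriented surface (a cellular embedding of a finite connected graph,
loops and multiple edges allowed), given by its standard combinatorial description: the finite
nonempty set of darts (arcs, that is, directed edges), the permutation `rot` which sends each dart to
the next dart with the same initial vertex according to the orientation, and the fixed-point-free
involution `rev` which reverses each dart. The surface is connected, that is, the group generated by
`rot` and `rev` is transitive on the darts. Vertices, edges and faces are the cycles of `rot`, of
`rev` and of their product. -/
structure OrientedMap where
  Dart : Type u
  finite : Finite Dart
  nonempty : Nonempty Dart
  rot : Equiv.Perm Dart
  rev : Equiv.Perm Dart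
  rev_rev : ∀ d, rev (rev d) = d
  rev_ne : ∀ d, rev d ≠ d
  connected : MulAction.IsPretransitive (Subgroup.closure ({rot, rev} : Set (Equiv.Perm Dart))) Dart

namespace OrientedMap

attribute [instance] OrientedMap.finite OrientedMap.nonempty

/-- The vertices of a map: the cycles of its rotation. -/
def Vertex (M : OrientedMap.{u}) : Type u :=
  Quotient (Equiv.Perm.SameCycle.setoid M.rot)

/-- The initial vertex of a dart. -/
def tail (M : OrientedMap.{u}) (d : M.Dart) : M.Vertex :=
  Quotient.mk (Equiv.Perm.SameCycle.setoid M.rot) d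

/-- Orientation-preserving isomorphisms of maps. -/
structure Iso (M : OrientedMap.{u}) (N : OrientedMap.{v}) where
  toEquiv : M.Dart ≃ N.Dart
  map_rot : ∀ d, toEquiv (M.rot d) = N.rot (toEquiv d)
  map_rev : ∀ d, toEquiv (M.rev d) = N.rev (toEquiv d)

/-- A map is orientably regular if its orientation-preserving automorphisms
act transitively on its darts. -/
def IsOrientablyRegular (M : OrientedMap.{u}) : Prop :=
  ∀ d d' : M.Dart, ∃ f : Iso M M, f.toEquiv d = d'

/-- The map `M` is an embedding of the simple graph `G`: the graph underlying `M`, with its vertices,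
its darts, the initial vertices of the darts and the reversal of darts, is isomorphic to `G`. -/
def IsEmbeddingOf (M : OrientedMap.{u}) {V : Type v} (G : SimpleGraph V) : Prop :=
  ∃ (φ : M.Vertex ≃ V) (ψ : M.Dart ≃ G.Dart),
    (∀ d, (ψ d).fst = φ (M.tail d)) ∧ ∀ d, ψ (M.rev d) = (ψ d).symm

/-- Being isomorphic is an equivalence relation on maps. -/
theorem iso_equivalence :
    Equivalence (fun M N : OrientedMap.{u} => Nonempty (Iso M N)) where
  refl M := ⟨⟨Equiv.refl _, fun _ => rfl, fun _ => rfl⟩⟩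
  symm := by
    rintro M N ⟨f⟩
    exact ⟨⟨f.toEquiv.symm,
      fun d => by rw [Equiv.symm_apply_eq, f.map_rot, Equiv.apply_symm_apply],
      fun d => by rw [Equiv.symm_apply_eq, f.map_rev, Equiv.apply_symm_apply]⟩⟩
  trans := by
    rintro M N K ⟨f⟩ ⟨g⟩
    exact ⟨⟨f.toEquiv.trans g.toEquiv,
      fun d => by simp [f.map_rot, g.map_rot],
      fun d => by simp [f.map_rev, g.map_rev]⟩⟩

end OrientedMap

section Paley

variable (F : Type u) [Field F]

/-- The generators `s` of the group of nonzero squares. -/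
abbrev PaleyGenerator : Type u :=
  {s : Fˣ // Subgroup.zpowers s = Subgroup.square Fˣ}

variable [Finite F]

theorem paley_isSquare_neg_one (hF : Nat.card F % 4 = 1) : IsSquare (-1 : F) := by
  have := Fintype.ofFinite F
  rw [FiniteField.isSquare_neg_one_iff, ← Nat.card_eq_fintype_card]
  omega

/-- The Paley graph of a finite field of order congruent to 1 modulo 4: two elements are adjacent
if and only if their difference is a nonzero square. -/
def paleyGraph (hF : Nat.card F % 4 = 1) : SimpleGraph F where
  Adj v w := v - w ≠ 0 ∧ IsSquare (v - w)
  symm := by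
    constructor
    rintro v w ⟨h0, h⟩
    rw [← neg_sub v w]
    refine ⟨neg_ne_zero.mpr h0, ?_⟩
    rw [← neg_one_mul]
    exact (paley_isSquare_neg_one F hF).mul h
  loopless := ⟨fun v h => h.1 (sub_self v)⟩

variable {F}

theorem PaleyGenerator.isSquare (s : PaleyGenerator F) : IsSquare ((s.1 : Fˣ) : F) := by
  have h : s.1 ∈ Subgroup.square Fˣ := s.2.le (Subgroup.mem_zpowers s.1)
  obtain ⟨r, hr⟩ := Subgroup.mem_square.mp h
  exact ⟨r, by rw [hr, Units.val_mul]⟩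

theorem PaleyGenerator.isSquare_inv (s : PaleyGenerator F) :
    IsSquare (((s.1)⁻¹ : Fˣ) : F) := by
  rw [Units.val_inv_eq_inv_val]
  exact s.isSquare.inv

theorem paleyGraph_adj_mul (hF : Nat.card F % 4 = 1) {t : Fˣ} (ht : IsSquare (t : F)) {v w : F}
    (h : (paleyGraph F hF).Adj v w) : (paleyGraph F hF).Adj v (v + t * (w - v)) := by
  obtain ⟨h0, h1⟩ := h
  have e : v - (v + t * (w - v)) = t * (v - w) := by ring
  refine ⟨?_, ?_⟩
  · rw [e]; exact mul_ne_zero t.ne_zero h0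
  · rw [e]; exact ht.mul h1

/-- The rotation of the Paley map of `s`: it sends the dart from `v` to `v + a` to the dart
from `v` to `v + s * a`. -/
def paleyRot (hF : Nat.card F % 4 = 1) (s : PaleyGenerator F) :
    Equiv.Perm (paleyGraph F hF).Dart where
  toFun d := ⟨(d.fst, d.fst + (s.1 : F) * (d.snd - d.fst)),
    paleyGraph_adj_mul hF s.isSquare d.adj⟩
  invFun d := ⟨(d.fst, d.fst + ((s.1⁻¹ : Fˣ) : F) * (d.snd - d.fst)),
    paleyGraph_adj_mul hF s.isSquare_inv d.adj⟩
  left_inv d := by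
    apply SimpleGraph.Dart.ext
    refine Prod.ext rfl ?_
    simp
  right_inv d := by
    apply SimpleGraph.Dart.ext
    refine Prod.ext rfl ?_
    simp

/-- The reversal of the darts of a graph. -/
def dartRev {V : Type u} (G : SimpleGraph V) : Equiv.Perm G.Dart where
  toFun := SimpleGraph.Dart.symm
  invFun := SimpleGraph.Dart.symm
  left_inv := SimpleGraph.Dart.symm_symm
  right_inv := SimpleGraph.Dart.symm_symm

theorem paleyRot_pow (hF : Nat.card F % 4 = 1) (s : PaleyGenerator F) (k : ℕ)
    (d : (paleyGraph F hF).Dart) :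
    ((paleyRot hF s ^ k) d).fst = d.fst ∧
      ((paleyRot hF s ^ k) d).snd = d.fst + ((s.1 ^ k : Fˣ) : F) * (d.snd - d.fst) := by
  induction k with
  | zero => simp
  | succ k ih =>
    rw [pow_succ', Equiv.Perm.mul_apply]
    obtain ⟨h1, h2⟩ := ih
    refine ⟨h1, ?_⟩
    change ((paleyRot hF s ^ k) d).fst + (s.1 : F) *
      (((paleyRot hF s ^ k) d).snd - ((paleyRot hF s ^ k) d).fst) = _
    rw [h1, h2, pow_succ', Units.val_mul]
    ring

theorem paleyRot_transitive (hF : Nat.card F % 4 = 1) (s : PaleyGenerator F)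
    (d d' : (paleyGraph F hF).Dart) (h : d.fst = d'.fst) :
    ∃ k : ℕ, (paleyRot hF s ^ k) d = d' := by
  obtain ⟨h0, x, hx⟩ := d.adj
  obtain ⟨h0', y, hy⟩ := d'.adj
  have hx0 : x ≠ 0 := by rintro rfl; exact h0 (by rw [hx, zero_mul])
  have hy0 : y ≠ 0 := by rintro rfl; exact h0' (by rw [hy, zero_mul])
  have hz : (Units.mk0 (y / x) (div_ne_zero hy0 hx0)) ^ 2 ∈ Subgroup.zpowers s.1 := by
    rw [s.2, Subgroup.mem_square]
    exact IsSquare.sq _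
  rw [← mem_powers_iff_mem_zpowers] at hz
  obtain ⟨k, hk⟩ := hz
  refine ⟨k, ?_⟩
  obtain ⟨h1, h2⟩ := paleyRot_pow hF s k d
  apply SimpleGraph.Dart.ext
  refine Prod.ext (h1.trans h) (h2.trans ?_)
  have hk' : ((s.1 ^ k : Fˣ) : F) = (y / x) ^ 2 := by
    rw [show s.1 ^ k = _ from hk]; simp
  rw [hk', ← neg_sub d.fst d.snd, hx]
  have : (y / x) ^ 2 * -(x * x) = -(y * y) := by field_simp
  rw [this, ← hy, h]
  ring

theorem paleyGraph_reachable (hF : Nat.card F % 4 = 1) (v w : F) :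
    (paleyGraph F hF).Reachable v w := by
  have step : ∀ a b : F, IsSquare (a - b) → (paleyGraph F hF).Reachable a b := by
    intro a b h
    by_cases h0 : a - b = 0
    · rw [sub_eq_zero.mp h0]
    · exact SimpleGraph.Adj.reachable ⟨h0, h⟩
  have h2 : (2 : F) ≠ 0 := by
    have := Fintype.ofFinite F
    apply Ring.two_ne_zero
    intro h
    have := FiniteField.even_card_iff_char_two.mp h
    rw [← Nat.card_eq_fintype_card] at this
    omega
  refine (step v (v - ((v - w + 1) / 2) * ((v - w + 1) / 2)) 
    ⟨(v - w + 1) / 2, by ring⟩).trans (step _ _ ?_)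
  have e : v - ((v - w + 1) / 2) * ((v - w + 1) / 2) - w
      = -1 * (((v - w - 1) / 2) * ((v - w - 1) / 2)) := by
    field_simp; ring
  rw [e]
  exact (paley_isSquare_neg_one F hF).mul ⟨_, rfl⟩

theorem paley_connected (hF : Nat.card F % 4 = 1) (s : PaleyGenerator F) :
    MulAction.IsPretransitive
      (Subgroup.closure ({paleyRot hF s, dartRev (paleyGraph F hF)} :
        Set (Equiv.Perm (paleyGraph F hF).Dart))) (paleyGraph F hF).Dart := by
  have hrot := Subgroup.subset_closure (k := ({paleyRot hF s, dartRev (paleyGraph F hF)} :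
        Set (Equiv.Perm (paleyGraph F hF).Dart))) (Set.mem_insert _ _)
  have hrev := Subgroup.subset_closure (k := ({paleyRot hF s, dartRev (paleyGraph F hF)} :
        Set (Equiv.Perm (paleyGraph F hF).Dart))) (Set.mem_insert_of_mem _ rfl)
  have key : ∀ {v w : F}, (paleyGraph F hF).Walk v w → ∀ d d' : (paleyGraph F hF).Dart,
      d.fst = v → d'.fst = w → ∃ g ∈ Subgroup.closure ({paleyRot hF s,
        dartRev (paleyGraph F hF)} : Set (Equiv.Perm (paleyGraph F hF).Dart)), g d = d' := by
    intro v w p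
    induction p with
    | nil =>
      intro d d' h h'
      obtain ⟨k, hk⟩ := paleyRot_transitive hF s d d' (h.trans h'.symm)
      exact ⟨_, Subgroup.pow_mem _ hrot k, hk⟩
    | @cons a b c hab p ih =>
      intro d d' h h'
      obtain ⟨k, hk⟩ := paleyRot_transitive hF s d ⟨(a, b), hab⟩ h
      obtain ⟨g, hg, hgd⟩ := ih (SimpleGraph.Dart.symm ⟨(a, b), hab⟩) d' rfl h'
      refine ⟨g * (dartRev (paleyGraph F hF) * paleyRot hF s ^ k),
        Subgroup.mul_mem _ hg (Subgroup.mul_mem _ hrev (Subgroup.pow_mem _ hrot k)), ?_⟩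
      rw [Equiv.Perm.mul_apply, Equiv.Perm.mul_apply, hk]
      exact hgd
  refine ⟨fun d d' => ?_⟩
  obtain ⟨p⟩ := paleyGraph_reachable hF d.fst d'.fst
  obtain ⟨g, hg, h⟩ := key p d d' rfl rfl
  exact ⟨⟨g, hg⟩, h⟩

/-- The Paley map of a generator `s` of the group of nonzero squares: the embedding of the Paley
graph in which the neighbours of each vertex `v` have the cyclic order
`v + 1, v + s, v + s ^ 2, …`. -/
def paleyMap (hF : Nat.card F % 4 = 1) (s : PaleyGenerator F) : OrientedMap.{u} where
  Dart := (paleyGraph F hF).Dart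
  finite := Finite.of_injective SimpleGraph.Dart.toProd
    (fun _ _ h => SimpleGraph.Dart.ext _ _ h)
  nonempty := ⟨⟨(1, 0), by simp [paleyGraph]⟩⟩
  rot := paleyRot hF s
  rev := dartRev (paleyGraph F hF)
  rev_rev := SimpleGraph.Dart.symm_symm
  rev_ne := SimpleGraph.Dart.symm_ne
  connected := paley_connected hF s

/-- Two generators are equivalent if their Paley maps are isomorphic. The classes correspond to
the isomorphism classes of Paley maps. -/
def paleyIsoSetoid (hF : Nat.card F % 4 = 1) : Setoid (PaleyGenerator F) where
  r s t := Nonempty (OrientedMap.Iso (paleyMap hF s) (paleyMap hF t))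
  iseqv :=
    { refl := fun _ => OrientedMap.iso_equivalence.refl _
      symm := fun h => OrientedMap.iso_equivalence.symm h
      trans := fun h h' => OrientedMap.iso_equivalence.trans h h' }

end Paley

/-! ### Powers of difference-preserving functions as polynomials; base `p` digits -/

section Carlitz

open Polynomial

/-! Write q for the order of F and m = (q - 1) / 2. The foundation is Carlitz's theorem,
`FiniteField.exists_eq_pow_of_sub_pow_eq`, which forces automorphisms of the Paley graph to have the
form x ↦ b + a x^(p^k). Its proof shows that suitable powers of f, in particular f^(p^j) for j < e,
are polynomials of degree at most m. Multiplying them bounds the sum of the degrees of the f^(p^j)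
by 1 + p + ⋯ + p^(e-1), and this bound is so tight that f must be a single monomial x^(p^k).

In a regular embedding, some automorphism of the map turns the darts at 0 by one step, so the
rotation at 0 is x ↦ s x^(p^j). It must run through all nonzero squares in one cycle; a nontrivial
field automorphism makes the cycle too short (`pow_pow_eq_self_of_cycle`), so the rotation at 0 is
multiplication by a generator s of the squares. At any other vertex v it is multiplication by some
σ(v), a conjugate of s. The symmetries of the map make σ invariant under enough translations to be
constant (`exists_eq_paleyRot`), so the map is a Paley map. Conversely, the affine maps with square
slope make every Paley map regular.

Isomorphisms between Paley maps are again graph automorphisms, and only their Frobenius part changes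
the generator. Thus the isomorphism classes are the Frobenius orbits on the φ(m) generators, and
each orbit has exactly e elements. -/

theorem Polynomial.eq_of_eval_eq_of_natDegree_lt_card {F : Type*} [Field F] [Fintype F]
    {f g : F[X]} (hf : f.natDegree < Fintype.card F) (hg : g.natDegree < Fintype.card F)
    (h : ∀ x, f.eval x = g.eval x) : f = g := by
  rw [← sub_eq_zero]
  refine eq_zero_of_natDegree_lt_card_of_eval_eq_zero (f - g) (f := id) Function.injective_id
    (fun x => by simp [h x]) ?_
  exact (natDegree_sub_le f g).trans_lt (max_lt hf hg)

theorem linearIndependent_pow_functions (F : Type*) [Field F] [Fintype F] {I : Finset ℕ}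
    (hI : ∀ i ∈ I, i < Fintype.card F) :
    LinearIndependent F (fun (i : I) (x : F) => x ^ (i : ℕ)) := by
  rw [Fintype.linearIndependent_iff]
  intro c hc i
  have h0 : (∑ j : I, C (c j) * X ^ (j : ℕ) : F[X]) = 0 := by
    apply eq_of_eval_eq_of_natDegree_lt_card
    · refine (natDegree_sum_le_of_forall_le (n := Fintype.card F - 1) _ _ ?_).trans_lt
        (Nat.sub_lt Fintype.card_pos one_pos)
      intro j _
      have := hI j j.2
      exact (natDegree_C_mul_X_pow_le _ _).trans (by omega)
    · simp [Fintype.card_pos]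
    · intro x
      have := congrFun hc x
      simpa [eval_finsetSum] using this
  have h1 := congrArg (fun P : F[X] => P.coeff (i : ℕ)) h0
  simpa [finsetSum_coeff, coeff_C_mul, coeff_X_pow, Subtype.val_inj] using h1

/-- If `f` preserves the `m`-th powers of differences, then each power `f ^ i` whose exponent
occurs in the binomial expansion of `(x - y) ^ m` is a polynomial function of degree at
most `m`. -/
theorem exists_polynomial_pow_of_sub_pow_eq {F : Type*} [Field F] [Fintype F] {m : ℕ}
    (hm : m < Fintype.card F) {f : F → F} (hf : ∀ x y, (f x - f y) ^ m = (x - y) ^ m)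
    {i : ℕ} (hi : i ≤ m) (hc : (m.choose i : F) ≠ 0) :
    ∃ g : F[X], g.natDegree ≤ m ∧ ∀ x, g.eval x = f x ^ i := by
  classical
  set I : Finset ℕ := (Finset.range (m + 1)).filter (fun i => (m.choose i : F) ≠ 0) with hI
  have memI : ∀ k, k ∈ I ↔ k ≤ m ∧ (m.choose k : F) ≠ 0 := by
    intro k; simp [hI]
  set bx : I → F → F := fun i x => x ^ (i : ℕ) with hbx
  set bf : I → F → F := fun i x => f x ^ (i : ℕ) with hbf
  have hle : Submodule.span F (Set.range bx) ≤ Submodule.span F (Set.range bf) := by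
    rw [Submodule.span_le]
    rintro _ ⟨k, rfl⟩
    -- Otherwise a functional `l` kills the listed powers of f but not x^k. Since (x + y)^m = (f x -
    -- f (-y))^m, it kills x ↦ (x + y)^m for every y. Expanded in y, this is a polynomial of degree
    -- at most m < q vanishing everywhere, and its coefficient at y^(m-k) is l(x^k) times a nonzero
    -- binomial coefficient.
    by_contra hk
    obtain ⟨l, hl, hker⟩ := Submodule.exists_le_ker_of_notMem hk
    have hbfl : ∀ j, l (bf j) = 0 := fun j => hker (Submodule.subset_span ⟨j, rfl⟩)
    obtain ⟨hkm, hkc⟩ := (memI k).mp k.2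
    have hQ : (∑ j ∈ Finset.range (m + 1),
        C (l (fun x => x ^ j) * (m.choose j : F)) * X ^ (m - j) : F[X]) = 0 := by
      apply eq_of_eval_eq_of_natDegree_lt_card
      · refine (natDegree_sum_le_of_forall_le (n := m) _ _ ?_).trans_lt hm
        intro j _
        exact (natDegree_C_mul_X_pow_le _ _).trans (by omega)
      · simp [Fintype.card_pos]
      · intro y
        have e1 : (fun x => (x + y) ^ m) = ∑ j ∈ Finset.range (m + 1),
            (y ^ (m - j) * (m.choose j : F)) • (fun x : F => x ^ j) := by
          funext x
          simp [add_pow, Finset.sum_apply, mul_comm, mul_assoc]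
        have e2 : (fun x => (x + y) ^ m) = ∑ j ∈ Finset.range (m + 1),
            ((- f (-y)) ^ (m - j) * (m.choose j : F)) • (fun x : F => f x ^ j) := by
          funext x
          have := hf x (-y)
          rw [sub_neg_eq_add] at this
          rw [← this, sub_eq_add_neg, add_pow]
          simp [Finset.sum_apply, mul_comm, mul_left_comm]
        have e3 : l (fun x => (x + y) ^ m) = 0 := by
          rw [e2, map_sum]
          refine Finset.sum_eq_zero fun j hj => ?_
          rw [map_smul]
          by_cases h : (m.choose j : F) = 0
          · simp [h]
          · have := hbfl ⟨j, (memI j).mpr ⟨by simpa [Nat.lt_succ_iff] using hj, h⟩⟩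
            simp only [hbf] at this
            simp [this]
        rw [e1, map_sum] at e3
        rw [eval_zero, ← e3, eval_finsetSum]
        refine Finset.sum_congr rfl fun j _ => ?_
        simp only [map_smul, smul_eq_mul, eval_mul, eval_C, eval_pow, eval_X]
        ring
    have h1 := congrArg (fun P : F[X] => P.coeff (m - k)) hQ
    simp only [finsetSum_coeff, coeff_C_mul, coeff_X_pow, coeff_zero] at h1
    rw [Finset.sum_eq_single (k : ℕ)] at h1
    · simp [hkc] at h1
      exact hl h1
    · intro j hj hjk
      rw [Finset.mem_range] at hj
      rw [if_neg (by omega), mul_zero]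
    · intro h
      exact absurd (Finset.mem_range.mpr (by omega)) h
  -- The monomials are independent and the powers of f are equally many, so the inclusion of spans
  -- is an equality; hence each listed power of f is a combination of monomials of degree at most m.
  have heq := Submodule.eq_of_le_of_finrank_le hle (by
    rw [finrank_span_eq_card (linearIndependent_pow_functions F
      (fun i hi => (((memI i).mp hi).1).trans_lt hm))]
    exact finrank_range_le_card bf)
  let ev : F[X] →ₗ[F] (F → F) :=
    { toFun := fun P x => P.eval x
      map_add' := fun P Q => by funext x; simp
      map_smul' := fun c P => by funext x; simp }
  have hmap : Submodule.span F (Set.range bx) ≤ (degreeLE F (m : ℕ)).map ev := by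
    rw [Submodule.span_le]
    rintro _ ⟨k, rfl⟩
    refine ⟨X ^ (k : ℕ), ?_, ?_⟩
    · rw [SetLike.mem_coe, mem_degreeLE]
      exact (degree_X_pow_le _).trans (by exact_mod_cast ((memI k).mp k.2).1)
    · funext x
      simp [ev, hbx]
  rw [heq] at hmap
  obtain ⟨g, hg, hgf⟩ := hmap (Submodule.subset_span ⟨⟨i, (memI i).mpr ⟨hi, hc⟩⟩, rfl⟩)
  exact ⟨g, natDegree_le_iff_degree_le.mpr (mem_degreeLE.mp hg), fun x => congrFun hgf x⟩

/-- By Lucas, the binomial coefficient is modulo p the product of the `h.choose (k j)`, none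
divisible by p because each divides h! and h < p. -/
theorem Nat.Prime.not_dvd_choose_sum_digits {p h : ℕ} (hp : p.Prime) (hh : h < p) (k : ℕ → ℕ)
    (hk : ∀ j, k j ≤ h) (e : ℕ) :
    ¬ p ∣ (∑ j ∈ Finset.range e, h * p ^ j).choose (∑ j ∈ Finset.range e, k j * p ^ j) := by
  have := Fact.mk hp
  induction e generalizing k with
  | zero => simpa using hp.one_lt.ne'
  | succ e ih =>
    have split : ∀ c : ℕ → ℕ, ∑ j ∈ Finset.range (e + 1), c j * p ^ j
        = c 0 + p * ∑ j ∈ Finset.range e, c (j + 1) * p ^ j := by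
      intro c
      rw [Finset.sum_range_succ', Finset.mul_sum, pow_zero, mul_one, add_comm]
      congr 1
      exact Finset.sum_congr rfl fun j _ => by ring
    rw [split k, split (fun _ => h),
      (Choose.choose_modEq_choose_mod_mul_choose_div_nat (p := p)).dvd_iff dvd_rfl]
    have h0 : k 0 < p := (hk 0).trans_lt hh
    rw [Nat.add_mul_mod_self_left, Nat.add_mul_mod_self_left, Nat.mod_eq_of_lt hh,
      Nat.mod_eq_of_lt h0, Nat.add_mul_div_left _ _ hp.pos, Nat.add_mul_div_left _ _ hp.pos,
      Nat.div_eq_of_lt hh, Nat.div_eq_of_lt h0, zero_add, zero_add, hp.dvd_mul]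
    rintro (h1 | h1)
    · have h2 := (Nat.choose_pos (hk 0))
      have h3 : h.choose (k 0) ∣ h.factorial :=
        ⟨(k 0).factorial * (h - k 0).factorial, by
          rw [← mul_assoc]; exact (Nat.choose_mul_factorial_mul_factorial (hk 0)).symm⟩
      exact absurd ((hp.dvd_factorial).mp (h1.trans h3)) (by omega)
    · exact ih (fun j => k (j + 1)) (fun j => hk (j + 1)) h1

/-- A nonzero residue modulo `p ^ e - 1` all of whose multiples by powers of `p` sum to
`1 + p + ⋯ + p ^ (e - 1)` is a power of `p`. -/
theorem exists_eq_pow_of_sum_mod_eq {p e n : ℕ} (hp : 2 ≤ p) (hn : n < p ^ e - 1)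
    (hsum : ∑ j ∈ Finset.range e, n * p ^ j % (p ^ e - 1) = ∑ j ∈ Finset.range e, p ^ j) :
    ∃ k, n = p ^ k := by
  set Q := p ^ e - 1 with hQ
  have hQ0 : 0 < Q := by omega
  have hpe : p ^ e = Q + 1 := by omega
  set r : ℕ → ℕ := fun j => n * p ^ j % Q with hr
  -- `d j` is the carry when the residue `r j` is multiplied by p and reduced modulo Q.
  set d : ℕ → ℕ := fun j => p * r j / Q with hd
  have hr0 : r 0 = n := by simp [hr, Nat.mod_eq_of_lt hn]
  have hre : r e = n := by
    simp only [hr, hpe, mul_add, mul_one]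
    rw [Nat.mul_add_mod_self_right, Nat.mod_eq_of_lt hn]
  have hstep : ∀ j, p * r j = Q * d j + r (j + 1) := by
    intro j
    have h1 := Nat.div_add_mod (p * r j) Q
    have h2 : p * r j % Q = r (j + 1) := by
      simp only [hr]
      rw [Nat.mul_mod, Nat.mod_mod, ← Nat.mul_mod]
      congr 1; ring
    rw [h2] at h1
    exact h1.symm
  have hgeom : (p - 1) * ∑ j ∈ Finset.range e, p ^ j = Q := by
    rw [mul_comm, hQ]; exact geom_sum_mul_of_one_le (by omega) e
  have hshift : ∑ j ∈ Finset.range e, r (j + 1) = ∑ j ∈ Finset.range e, r j := by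
    have h1 := Finset.sum_range_succ r e
    have h2 := Finset.sum_range_succ' r e
    rw [hr0] at h2; rw [hre] at h1
    omega
  -- The residues are periodic with period e, so summing p r_j = Q d_j + r_(j+1) gives (p - 1) Σ r_j
  -- = Q Σ d_j. The left side is Q by hypothesis, so exactly one carry occurs.
  have hD : ∑ j ∈ Finset.range e, d j = 1 := by
    have h1 : p * ∑ j ∈ Finset.range e, r j
        = Q * ∑ j ∈ Finset.range e, d j + ∑ j ∈ Finset.range e, r j := by
      rw [Finset.mul_sum, Finset.sum_congr rfl (fun j _ => hstep j), Finset.sum_add_distrib,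
        hshift, Finset.mul_sum]
    have h2 : p * ∑ j ∈ Finset.range e, r j
        = Q + ∑ j ∈ Finset.range e, r j := by
      have h3 : ∑ j ∈ Finset.range e, r j = ∑ j ∈ Finset.range e, p ^ j := hsum
      rw [h3]
      nth_rewrite 1 [← hgeom]
      obtain ⟨p', rfl⟩ : ∃ p', p = p' + 1 := ⟨p - 1, by omega⟩
      simp; ring
    have h3 : Q * ∑ j ∈ Finset.range e, d j = Q * 1 := by omega
    exact Nat.eq_of_mul_eq_mul_left hQ0 h3
  obtain ⟨j₀, hj₀, hdj⟩ : ∃ j ∈ Finset.range e, d j ≠ 0 := by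
    by_contra! h
    rw [Finset.sum_eq_zero h] at hD
    omega
  have hother : d j₀ = 1 ∧ ∀ j ∈ Finset.range e, j ≠ j₀ → d j = 0 := by
    rw [← Finset.add_sum_erase _ _ hj₀] at hD
    refine ⟨by omega, fun j hj hne => ?_⟩
    have h0 : ∑ j ∈ (Finset.range e).erase j₀, d j = 0 := by omega
    exact (Finset.sum_eq_zero_iff.mp h0) j (Finset.mem_erase.mpr ⟨hne, hj⟩)
  rw [Finset.mem_range] at hj₀
  -- Away from the single carry at `j₀` the residues are just multiplied by p. Following them around
  -- the cycle gives p^e r = Q + r for r = r_(j₀+1), so r = 1 and n is a power of p.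
  have hlow : ∀ j ≤ j₀, r j = p ^ j * n := by
    intro j
    induction j with
    | zero => intro _; simp [hr0]
    | succ j ih =>
      intro hj
      have h1 := hstep j
      rw [hother.2 j (Finset.mem_range.mpr (by omega)) (by omega), ih (by omega)] at h1
      rw [pow_succ']; linarith
  have hhigh : ∀ t, j₀ + 1 + t ≤ e → r (j₀ + 1 + t) = p ^ t * r (j₀ + 1) := by
    intro t
    induction t with
    | zero => intro _; simp
    | succ t ih =>
      intro ht
      have h1 := hstep (j₀ + 1 + t)
      rw [hother.2 _ (Finset.mem_range.mpr (by omega)) (by omega), ih (by omega)] at h1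
      rw [pow_succ', ← add_assoc]; linarith
  have h1 := hhigh (e - 1 - j₀) (by omega)
  rw [show j₀ + 1 + (e - 1 - j₀) = e by omega, hre] at h1
  have h2 := hstep j₀
  rw [hother.1, hlow j₀ le_rfl, h1] at h2
  have h3 : p * (p ^ j₀ * (p ^ (e - 1 - j₀) * r (j₀ + 1))) = p ^ e * r (j₀ + 1) := by
    have : p ^ e = p ^ (j₀ + 1 + (e - 1 - j₀)) := by congr 1; omega
    rw [this]; ring
  rw [h3, hpe] at h2
  have h4 : r (j₀ + 1) = 1 := by
    have : Q * r (j₀ + 1) = Q * 1 := by linarith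
    exact Nat.eq_of_mul_eq_mul_left hQ0 this
  exact ⟨e - 1 - j₀, by rw [h1, h4, mul_one]⟩

end Carlitz


/-! ### Coefficient extraction by power sums, and Carlitz's theorem -/

section Carlitz

open Polynomial

theorem FiniteField.sum_pow_add_card_sub_one_sub {F : Type*} [Field F] [Fintype F] {k i : ℕ}
    (hk : k < Fintype.card F - 1) (hi : i < Fintype.card F - 1) :
    ∑ x : F, x ^ (k + (Fintype.card F - 1 - i)) = if k = i then -1 else 0 := by
  classical
  rcases lt_trichotomy k i with h | h | h
  · rw [if_neg h.ne]
    exact FiniteField.sum_pow_lt_card_sub_one F _ (by omega)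
  · rw [if_pos h, h, show i + (Fintype.card F - 1 - i) = Fintype.card F - 1 by omega]
    have : ∀ x : F, x ^ (Fintype.card F - 1) = 1 - if x = 0 then 1 else 0 := by
      intro x
      split_ifs with hx
      · rw [hx, zero_pow (by omega), sub_self]
      · rw [FiniteField.pow_card_sub_one_eq_one x hx, sub_zero]
    simp [this]
  · rw [if_neg h.ne']
    rw [← FiniteField.sum_pow_lt_card_sub_one F (k - i) (by omega)]
    refine Finset.sum_congr rfl fun x _ => ?_
    rw [show k + (Fintype.card F - 1 - i) = (k - i) + (Fintype.card F - 1) by omega, pow_add]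
    by_cases hx : x = 0
    · rw [hx, zero_pow (by omega), zero_mul]
    · rw [FiniteField.pow_card_sub_one_eq_one x hx, mul_one]

/-- Power sums over the field are orthogonal, so they read off coefficients from values alone.
Degree q - 1 is excluded because x^(q-1) and the constant 1 are not separated by these sums. -/
theorem FiniteField.sum_eval_mul_pow {F : Type*} [Field F] [Fintype F] {g : F[X]}
    (hg : g.natDegree < Fintype.card F - 1) {i : ℕ} (hi : i < Fintype.card F - 1) :
    ∑ x : F, g.eval x * x ^ (Fintype.card F - 1 - i) = - g.coeff i := by
  simp_rw [eval_eq_sum_range' hg, Finset.sum_mul]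
  rw [Finset.sum_comm]
  have : ∀ k ∈ Finset.range (Fintype.card F - 1),
      ∑ x : F, g.coeff k * x ^ k * x ^ (Fintype.card F - 1 - i)
        = if k = i then - g.coeff k else 0 := by
    intro k hk
    rw [Finset.mem_range] at hk
    simp_rw [mul_assoc, ← pow_add]
    rw [← Finset.mul_sum, FiniteField.sum_pow_add_card_sub_one_sub hk hi]
    split_ifs <;> simp
  rw [Finset.sum_congr rfl this, Finset.sum_ite_eq', if_pos (Finset.mem_range.mpr hi)]

theorem FiniteField.pow_eq_pow_of_modEq {F : Type*} [Field F] [Fintype F] {a b : ℕ}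
    (ha : a ≠ 0) (hb : b ≠ 0) (h : a ≡ b [MOD Fintype.card F - 1]) (x : F) : x ^ a = x ^ b := by
  by_cases hx : x = 0
  · rw [hx, zero_pow ha, zero_pow hb]
  · exact _root_.pow_eq_pow_of_modEq h (FiniteField.pow_card_sub_one_eq_one x hx)

/-- The reduced polynomial of a `p ^ j`-th power of a polynomial function has the exponents
multiplied by `p ^ j` modulo `q - 1`. -/
theorem FiniteField.mod_le_natDegree_of_eval_eq_pow {F : Type*} [Field F] [Fintype F] (p : ℕ)
    [Fact p.Prime] [CharP F p] {g g' : F[X]} (hg : g.natDegree < Fintype.card F - 1)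
    (hg' : g'.natDegree < Fintype.card F - 1) {j : ℕ} (h : ∀ x, g'.eval x = g.eval x ^ p ^ j)
    {i : ℕ} (hi : g.coeff i ≠ 0) :
    i * p ^ j % (Fintype.card F - 1) ≤ g'.natDegree := by
  have hi' : i < Fintype.card F - 1 := (le_natDegree_of_ne_zero hi).trans_lt hg
  have hmod : i * p ^ j % (Fintype.card F - 1) < Fintype.card F - 1 := Nat.mod_lt _ (by omega)
  apply le_natDegree_of_ne_zero
  rw [← neg_ne_zero, ← FiniteField.sum_eval_mul_pow hg' hmod]
  -- The two exponents of x are positive, and both become multiples of q - 1 after adding i p^j.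
  -- Hence the power sum for g' is the p^j-th power of the one for g, by additivity of Frobenius.
  have : ∀ x : F, g'.eval x * x ^ (Fintype.card F - 1 - i * p ^ j % (Fintype.card F - 1))
      = (g.eval x * x ^ (Fintype.card F - 1 - i)) ^ p ^ j := by
    intro x
    rw [h, mul_pow, ← pow_mul]
    congr 1
    have hp := (Fact.out : p.Prime).pos
    apply FiniteField.pow_eq_pow_of_modEq (by omega)
      (Nat.mul_ne_zero (by omega) (pow_pos hp j).ne')
    have e1 : Fintype.card F - 1 - i * p ^ j % (Fintype.card F - 1) + i * p ^ j
        ≡ 0 [MOD Fintype.card F - 1] := by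
      have h1 : Fintype.card F - 1 - i * p ^ j % (Fintype.card F - 1) + i * p ^ j
        ≡ Fintype.card F - 1 - i * p ^ j % (Fintype.card F - 1)
          + i * p ^ j % (Fintype.card F - 1) [MOD Fintype.card F - 1] :=
        (Nat.mod_modEq _ _).symm.add_left _
      rw [Nat.sub_add_cancel hmod.le] at h1
      exact h1.trans (by simp [Nat.ModEq])
    have e2 : (Fintype.card F - 1 - i) * p ^ j + i * p ^ j ≡ 0 [MOD Fintype.card F - 1] := by
      rw [← add_mul, Nat.sub_add_cancel hi'.le]
      simp [Nat.ModEq]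
    exact Nat.ModEq.add_right_cancel' _ (e1.trans e2.symm)
  simp_rw [this]
  rw [← sum_pow_char_pow, FiniteField.sum_eval_mul_pow hg hi']
  exact pow_ne_zero _ (neg_ne_zero.mpr hi)

/-- **Carlitz's theorem.** A function on a finite field of odd order which fixes `0` and `1` and
preserves the quadratic character of all differences is a power of the Frobenius map. -/
theorem FiniteField.exists_eq_pow_of_sub_pow_eq {F : Type*} [Field F] [Fintype F] {p e : ℕ}
    (hp : p.Prime) (hp2 : p ≠ 2) (hq : Fintype.card F = p ^ e) {f : F → F} (h0 : f 0 = 0)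
    (h1 : f 1 = 1)
    (hf : ∀ x y, (f x - f y) ^ (Fintype.card F / 2) = (x - y) ^ (Fintype.card F / 2)) :
    ∃ k, ∀ x, f x = x ^ p ^ k := by
  have := Fact.mk hp
  have := charP_of_card_eq_prime_pow hq
  obtain ⟨h, hh⟩ := hp.odd_of_ne_two hp2
  have hh0 : 0 < h := by have := hp.one_lt; omega
  set m := Fintype.card F / 2 with hm
  set N := ∑ j ∈ Finset.range e, p ^ j with hN
  have hgeom : 2 * (h * N) = Fintype.card F - 1 := by
    have := geom_sum_mul_of_one_le (x := p) hp.one_le e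
    rw [hq, ← this, ← hN, show p - 1 = 2 * h by omega]
    ring
  have hcard := Fintype.one_lt_card (α := F)
  have hmN : m = h * N := by omega
  have hmN' : m = ∑ j ∈ Finset.range e, h * p ^ j := by rw [hmN, hN, Finset.mul_sum]
  have hmq : 2 * m < Fintype.card F := by omega
  -- All base p digits of m equal h = (p - 1) / 2, so Lucas admits every exponent whose digits are
  -- at most h.
  have key : ∀ k : ℕ → ℕ, (∀ j, k j ≤ h) → ∃ g : F[X], g.natDegree ≤ m ∧
      ∀ x, g.eval x = f x ^ (∑ j ∈ Finset.range e, k j * p ^ j) := by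
    intro k hk
    refine exists_polynomial_pow_of_sub_pow_eq (by omega) hf ?_ ?_
    · rw [hmN']
      exact Finset.sum_le_sum fun j _ => Nat.mul_le_mul_right _ (hk j)
    · rw [Ne, CharP.cast_eq_zero_iff F p, hmN']
      exact hp.not_dvd_choose_sum_digits (by omega) k hk e
  have hg : ∀ j, ∃ g : F[X], j < e → g.natDegree ≤ m ∧ ∀ x, g.eval x = f x ^ p ^ j := by
    intro j
    by_cases hj : j < e
    · obtain ⟨g, hg, hgf⟩ := key (fun i => if i = j then 1 else 0)
        (fun i => by split_ifs <;> omega)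
      refine ⟨g, fun _ => ⟨hg, fun x => ?_⟩⟩
      rw [hgf]
      simp [hj]
    · exact ⟨0, fun h => absurd h hj⟩
  choose g hg using hg
  have hg0 : ∀ j < e, g j ≠ 0 := by
    intro j hj h
    have := (hg j hj).2 1
    rw [h, h1] at this
    simp at this
  -- Factors are added one at a time: the new product has degree at most 2m < q, so it equals the
  -- polynomial of degree at most m which `key` gives for the same function.
  have hprod : ∀ n : ℕ, ∀ k : ℕ → ℕ, (∀ j, k j ≤ h) → ∑ j ∈ Finset.range e, k j = n →
      (∏ j ∈ Finset.range e, g j ^ k j).natDegree ≤ m := by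
    intro n
    induction n with
    | zero =>
      intro k _ hk0
      rw [Finset.sum_eq_zero_iff] at hk0
      rw [Finset.prod_eq_one fun j hj => by rw [hk0 j hj, pow_zero]]
      simp
    | succ n ih =>
      intro k hk hkn
      obtain ⟨i, hi, hki⟩ : ∃ i ∈ Finset.range e, k i ≠ 0 := by
        by_contra! hc
        rw [Finset.sum_eq_zero hc] at hkn
        omega
      set k' := Function.update k i (k i - 1) with hk'
      have hkk' : ∀ j, k j = k' j + if j = i then 1 else 0 := by
        intro j
        by_cases hj : j = i
        · subst hj; simp [hk']; omega
        · simp [hk', hj]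
      have hprod' : ∏ j ∈ Finset.range e, g j ^ k j
          = (∏ j ∈ Finset.range e, g j ^ k' j) * g i := by
        simp_rw [hkk', pow_add, Finset.prod_mul_distrib, pow_ite, pow_one, pow_zero]
        rw [Finset.prod_ite_eq', if_pos hi]
      have hdeg := ih k' (fun j => (by have := hkk' j; have := hk j; omega)) (by
        have : ∑ j ∈ Finset.range e, k j = ∑ j ∈ Finset.range e, k' j + 1 := by
          simp_rw [hkk', Finset.sum_add_distrib]
          rw [Finset.sum_ite_eq', if_pos hi]
        omega)
      have hdeg2 : (∏ j ∈ Finset.range e, g j ^ k j).natDegree ≤ 2 * m := by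
        rw [hprod']
        refine natDegree_mul_le.trans ?_
        have := (hg i (Finset.mem_range.mp hi)).1
        omega
      obtain ⟨G, hG, hGf⟩ := key k hk
      rw [eq_of_eval_eq_of_natDegree_lt_card (g := G) (hdeg2.trans_lt hmq) (by omega)]
      · exact hG
      · intro x
        rw [hGf, eval_prod, ← Finset.prod_pow_eq_pow_sum]
        refine Finset.prod_congr rfl fun j hj => ?_
        rw [eval_pow, (hg j (Finset.mem_range.mp hj)).2, ← pow_mul, mul_comm]
  have hsum : ∑ j ∈ Finset.range e, (g j).natDegree ≤ N := by
    have h2 := hprod _ (fun _ => h) (fun _ => le_rfl) rfl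
    rw [natDegree_prod _ _ fun j hj => pow_ne_zero _ (hg0 j (Finset.mem_range.mp hj))] at h2
    simp_rw [natDegree_pow] at h2
    rw [← Finset.mul_sum, hmN] at h2
    exact Nat.le_of_mul_le_mul_left h2 hh0
  have he : 0 < e := by
    rcases Nat.eq_zero_or_pos e with rfl | he
    · simp at hq; omega
    · exact he
  have hfg : ∀ x, (g 0).eval x = f x := fun x => by rw [(hg 0 he).2, pow_zero, pow_one]
  have hlow : ∀ i, (g 0).coeff i ≠ 0 → ∀ j ∈ Finset.range e,
      i * p ^ j % (p ^ e - 1) ≤ (g j).natDegree := by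
    intro i hi j hj
    have hj' := hg j (Finset.mem_range.mp hj)
    rw [← hq]
    refine FiniteField.mod_le_natDegree_of_eval_eq_pow p
      (by have := (hg 0 he).1; omega) (by omega) ?_ hi
    intro x
    rw [hj'.2, hfg]
  have hpos : ∀ i, (g 0).coeff i ≠ 0 → 0 < i := by
    intro i hi
    rcases Nat.eq_zero_or_pos i with rfl | h
    · rw [coeff_zero_eq_eval_zero, hfg, h0] at hi
      exact absurd rfl hi
    · exact h
  have hNdvd : N ∣ p ^ e - 1 := ⟨2 * h, by rw [← hq, ← hgeom]; ring⟩
  have hlt : ∀ i, (g 0).coeff i ≠ 0 → i < p ^ e - 1 := by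
    intro i hi
    have := le_natDegree_of_ne_zero hi
    have := (hg 0 he).1
    omega
  -- The sum is at most N by the degree bound; it is positive, and congruent to iN modulo q - 1,
  -- hence divisible by N.
  have hsumeq : ∀ i, (g 0).coeff i ≠ 0 →
      ∑ j ∈ Finset.range e, i * p ^ j % (p ^ e - 1) = N := by
    intro i hi
    apply le_antisymm ((Finset.sum_le_sum (hlow i hi)).trans hsum)
    apply Nat.le_of_dvd
    · refine lt_of_lt_of_le ?_ (Finset.single_le_sum (f := fun j => i * p ^ j % (p ^ e - 1))
        (fun _ _ => Nat.zero_le _) (Finset.mem_range.mpr he))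
      simp only [pow_zero, mul_one]
      rw [Nat.mod_eq_of_lt (hlt i hi)]
      exact hpos i hi
    · rw [Nat.dvd_iff_mod_eq_zero, Finset.sum_nat_mod]
      simp_rw [Nat.mod_mod_of_dvd _ hNdvd]
      rw [← Finset.sum_nat_mod, ← Finset.mul_sum]
      exact Nat.mul_mod_left _ _
  -- Equality of the sums forces equality term by term; the term j = 0 says that only the leading
  -- monomial occurs.
  have huniq : ∀ i, (g 0).coeff i ≠ 0 → i = (g 0).natDegree := by
    intro i hi
    have h3 : ∑ j ∈ Finset.range e, i * p ^ j % (p ^ e - 1)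
        = ∑ j ∈ Finset.range e, (g j).natDegree :=
      le_antisymm (Finset.sum_le_sum (hlow i hi)) (by rw [hsumeq i hi]; exact hsum)
    have h4 := (Finset.sum_eq_sum_iff_of_le (hlow i hi)).mp h3 0 (Finset.mem_range.mpr he)
    rwa [pow_zero, mul_one, Nat.mod_eq_of_lt (hlt i hi)] at h4
  have hlead : (g 0).coeff (g 0).natDegree ≠ 0 := leadingCoeff_ne_zero.mpr (hg0 0 he)
  obtain ⟨k, hk⟩ := exists_eq_pow_of_sum_mod_eq hp.two_le (hlt _ hlead) (hsumeq _ hlead)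
  have heval : ∀ x, f x = (g 0).coeff (g 0).natDegree * x ^ p ^ k := by
    intro x
    rw [← hfg, eval_eq_sum_range, Finset.sum_eq_single (g 0).natDegree, ← hk]
    · intro i _ hi
      by_contra hc
      exact hi (huniq i fun h => hc (by rw [h, zero_mul]))
    · simp
  have hone := heval 1
  rw [h1, one_pow, mul_one] at hone
  exact ⟨k, fun x => by rw [heval x, ← hone, one_mul]⟩

end Carlitz


/-! ### Automorphisms of the Paley graph, generators of the squares, and cycle lengths -/

section PaleyAutomorphisms

variable {F : Type*} [Field F] [Finite F]

theorem ringChar_ne_two_of_card_mod_four (hF : Nat.card F % 4 = 1) : ringChar F ≠ 2 := by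
  have := Fintype.ofFinite F
  intro h
  have := FiniteField.even_card_iff_char_two.mp h
  rw [← Nat.card_eq_fintype_card] at this
  omega

theorem paleyGraph_adj_iff_pow_eq_one (hF : Nat.card F % 4 = 1) {v w : F} :
    (paleyGraph F hF).Adj v w ↔ (v - w) ^ (Nat.card F / 2) = 1 := by
  have := Fintype.ofFinite F
  have hc := Nat.card_eq_fintype_card (α := F)
  have h1 := Finite.one_lt_card (α := F)
  constructor
  · rintro ⟨h, hs⟩
    rw [hc]
    exact (FiniteField.isSquare_iff (ringChar_ne_two_of_card_mod_four hF) h).mp hs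
  · intro h
    have h0 : v - w ≠ 0 := by
      intro h0
      rw [h0, zero_pow (by omega)] at h
      exact zero_ne_one h
    refine ⟨h0, ?_⟩
    rw [hc] at h
    exact (FiniteField.isSquare_iff (ringChar_ne_two_of_card_mod_four hF) h0).mpr h

theorem paleyGraph_adj_add_iff (hF : Nat.card F % 4 = 1) {v y : F} :
    (paleyGraph F hF).Adj v (v + y) ↔ y ≠ 0 ∧ IsSquare y := by
  rw [SimpleGraph.adj_comm]
  simp [paleyGraph]

theorem paleyGraph_adj_affine (hF : Nat.card F % 4 = 1) {t : F} (ht0 : t ≠ 0) (ht : IsSquare t)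
    (b c : F) {v w : F} (h : (paleyGraph F hF).Adj v w) :
    (paleyGraph F hF).Adj (b + t * (v - c)) (b + t * (w - c)) := by
  have e : b + t * (v - c) - (b + t * (w - c)) = t * (v - w) := by ring
  refine ⟨?_, ?_⟩
  · rw [e]; exact mul_ne_zero ht0 h.1
  · rw [e]; exact ht.mul h.2

theorem exponent_pos_of_card {p e : ℕ} (hq : Nat.card F = p ^ e) : 0 < e := by
  have h1 := Finite.one_lt_card (α := F)
  rcases Nat.eq_zero_or_pos e with rfl | he
  · rw [pow_zero] at hq
    omega
  · exact he

theorem char_ne_two_of_card {p e : ℕ} (hq : Nat.card F = p ^ e)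
    (hF : Nat.card F % 4 = 1) : p ≠ 2 := by
  rintro rfl
  have : 2 ∣ 2 ^ e := dvd_pow_self 2 (exponent_pos_of_card hq).ne'
  omega

/-- Every automorphism of the Paley graph is of the form `x ↦ b + a * x ^ p ^ k`. -/
theorem paleyGraph_automorphism {p e : ℕ} (hp : p.Prime) (hq : Nat.card F = p ^ e)
    (hF : Nat.card F % 4 = 1) {α : F → F} (hinj : Function.Injective α)
    (hα : ∀ v w, (paleyGraph F hF).Adj (α v) (α w) ↔ (paleyGraph F hF).Adj v w) :
    ∃ k, ∀ x, α x = α 0 + (α 1 - α 0) * x ^ p ^ k := by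
  have := Fintype.ofFinite F
  have hc := Nat.card_eq_fintype_card (α := F)
  have h1 := Finite.one_lt_card (α := F)
  have hchar := ringChar_ne_two_of_card_mod_four hF
  have hne : α 1 - α 0 ≠ 0 := sub_ne_zero.mpr (hinj.ne one_ne_zero)
  have hpow : ∀ x y, (α x - α y) ^ (Fintype.card F / 2) = (x - y) ^ (Fintype.card F / 2) := by
    intro x y
    by_cases hxy : x = y
    · simp [hxy]
    · have h := hα x y
      rw [paleyGraph_adj_iff_pow_eq_one, paleyGraph_adj_iff_pow_eq_one, hc] at h
      rcases FiniteField.pow_dichotomy hchar (sub_ne_zero.mpr hxy) with h2 | h2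
      · rw [h2, h.mpr h2]
      · rcases FiniteField.pow_dichotomy hchar (sub_ne_zero.mpr (hinj.ne hxy)) with h3 | h3
        · rw [h3, h.mp h3]
        · rw [h2, h3]
  -- Normalising to fix 0 and 1 keeps the quadratic character, because α 1 - α 0 is itself a square
  -- (`hpow 1 0`).
  obtain ⟨k, hk⟩ := FiniteField.exists_eq_pow_of_sub_pow_eq (f := fun x => (α x - α 0) / (α 1 - α 0))
    hp (char_ne_two_of_card hq hF) (hc ▸ hq) (by simp) (div_self hne) (by
      intro x y
      rw [← sub_div, sub_sub_sub_cancel_right, div_pow, hpow x y, hpow 1 0]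
      simp)
  refine ⟨k, fun x => ?_⟩
  rw [← hk x, mul_div_cancel₀ _ hne]
  ring

theorem zpowers_eq_square_iff (hF : Nat.card F % 4 = 1) (s : Fˣ) :
    Subgroup.zpowers s = Subgroup.square Fˣ ↔ orderOf s = Nat.card F / 2 := by
  have := Fintype.ofFinite F
  have hc := Nat.card_eq_fintype_card (α := F)
  have h1 := Finite.one_lt_card (α := F)
  have hchar := ringChar_ne_two_of_card_mod_four hF
  have hsq : ∀ t : Fˣ, t ∈ Subgroup.square Fˣ ↔ t ^ (Nat.card F / 2) = 1 := by
    intro t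
    rw [Subgroup.mem_square, FiniteField.unit_isSquare_iff hchar, hc]
  obtain ⟨w, hw⟩ := IsCyclic.exists_generator (α := Fˣ)
  have how : orderOf w = Nat.card F - 1 := by
    rw [orderOf_eq_card_of_forall_mem_zpowers hw, Nat.card_units]
  have how2 : orderOf (w ^ 2) = Nat.card F / 2 := by
    rw [orderOf_pow_of_dvd (by omega) (by rw [how]; omega), how]
    omega
  constructor
  · intro h
    apply Nat.dvd_antisymm
    · exact orderOf_dvd_of_pow_eq_one ((hsq s).mp (h ▸ Subgroup.mem_zpowers s))
    · rw [← how2]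
      apply orderOf_dvd_of_mem_zpowers
      rw [h, Subgroup.mem_square]
      exact IsSquare.sq w
  · intro h
    have hle : Subgroup.zpowers s ≤ Subgroup.square Fˣ := by
      rw [Subgroup.zpowers_le, hsq, ← h, pow_orderOf_eq_one]
    have hle2 : Subgroup.square Fˣ ≤ Subgroup.zpowers (w ^ 2) := by
      intro t ht
      obtain ⟨r, rfl⟩ := Subgroup.mem_square.mp ht
      obtain ⟨z, rfl⟩ := Subgroup.mem_zpowers_iff.mp (hw r)
      exact Subgroup.mem_zpowers_iff.mpr ⟨z, by
        rw [← zpow_natCast, ← zpow_mul, ← zpow_add]; congr 1; push_cast; ring⟩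
    apply Subgroup.eq_of_le_of_card_ge hle
    rw [Nat.card_zpowers, h, ← how2, ← Nat.card_zpowers]
    exact Subgroup.card_le_of_le hle2

theorem exists_paleyGenerator (hF : Nat.card F % 4 = 1) : Nonempty (PaleyGenerator F) := by
  have h1 := Finite.one_lt_card (α := F)
  obtain ⟨w, hw⟩ := IsCyclic.exists_generator (α := Fˣ)
  have how : orderOf w = Nat.card F - 1 := by
    rw [orderOf_eq_card_of_forall_mem_zpowers hw, Nat.card_units]
  refine ⟨⟨w ^ 2, (zpowers_eq_square_iff hF _).mpr ?_⟩⟩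
  rw [orderOf_pow_of_dvd (by omega) (by rw [how]; omega), how]
  omega

theorem card_square_units (hF : Nat.card F % 4 = 1) :
    Nat.card (Subgroup.square Fˣ) = Nat.card F / 2 := by
  obtain ⟨s⟩ := exists_paleyGenerator hF
  rw [← s.2, Nat.card_zpowers]
  exact (zpowers_eq_square_iff hF _).mp s.2

theorem card_paleyGenerator (hF : Nat.card F % 4 = 1) :
    Nat.card (PaleyGenerator F) = Nat.totient (Nat.card F / 2) := by
  classical
  have := Fintype.ofFinite F
  have h1 := Finite.one_lt_card (α := F)
  rw [← IsCyclic.card_orderOf_eq_totient (α := Fˣ) (d := Nat.card F / 2)]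
  · rw [Nat.card_congr (Equiv.subtypeEquivRight fun s => zpowers_eq_square_iff hF s),
      Nat.card_eq_fintype_card, Fintype.card_subtype]
  · rw [← Nat.card_eq_fintype_card, Nat.card_units]
    exact ⟨2, by omega⟩

theorem pow_pow_eq_self_of_dvd {p e j : ℕ} (hq : Nat.card F = p ^ e) (h : e ∣ j) (x : F) :
    x ^ p ^ j = x := by
  have := Fintype.ofFinite F
  obtain ⟨t, rfl⟩ := h
  rw [pow_mul, ← hq, Nat.card_eq_fintype_card, FiniteField.pow_card_pow]

theorem pow_pow_gcd_eq_self {p e j : ℕ} (hq : Nat.card F = p ^ e) {u : F} (h : u ^ p ^ j = u) :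
    u ^ p ^ j.gcd e = u := by
  have hit : ∀ n, (fun x : F => x ^ p)^[n] u = u ^ p ^ n := by
    intro n
    induction n with
    | zero => simp
    | succ n ih => rw [Function.iterate_succ_apply', ih, ← pow_mul, pow_succ]
  have h1 : Function.IsPeriodicPt (fun x : F => x ^ p) j u := (hit j).trans h
  have h2 : Function.IsPeriodicPt (fun x : F => x ^ p) e u :=
    (hit e).trans (pow_pow_eq_self_of_dvd hq dvd_rfl u)
  exact (hit _).symm.trans (h1.gcd h2)

/-- If `x ↦ s * x ^ p ^ j` permutes the nonzero squares in a single cycle, then the field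
automorphism `x ↦ x ^ p ^ j` is trivial. -/
theorem pow_pow_eq_self_of_cycle {p e : ℕ} (hp : p.Prime) (hq : Nat.card F = p ^ e)
    (hF : Nat.card F % 4 = 1) {s : F} (hs0 : s ≠ 0) (hs : IsSquare s) {j : ℕ}
    (hcyc : ∀ t : F, t ≠ 0 → IsSquare t → ∃ k : ℕ, (fun x => s * x ^ p ^ j)^[k] 1 = t) (x : F) :
    x ^ p ^ j = x := by
  have h1 := Finite.one_lt_card (α := F)
  have hp2 := char_ne_two_of_card hq hF
  have hp3 : 3 ≤ p := by have := hp.two_le; omega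
  have he := exponent_pos_of_card hq
  set d := j.gcd e with hd
  have hd0 : 0 < d := Nat.gcd_pos_of_pos_right j he
  obtain ⟨f, hf⟩ : d ∣ e := Nat.gcd_dvd_right j e
  obtain ⟨i, hi⟩ : d ∣ j := Nat.gcd_dvd_left j e
  have hf0 : 0 < f := Nat.pos_of_ne_zero (by rintro rfl; omega)
  set P := p ^ j with hP
  set r := p ^ d with hr
  have hr3 : 3 ≤ r := hp3.trans (Nat.le_self_pow hd0.ne' p)
  have hrodd : Odd r := (hp.odd_of_ne_two hp2).pow
  obtain ⟨h, hh⟩ := hrodd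
  have hPf : ∀ y : F, y ^ P ^ f = y := by
    intro y
    rw [hP, ← pow_mul]
    exact pow_pow_eq_self_of_dvd hq ⟨i, by rw [hf, hi]; ring⟩ y
  set g : F → F := fun x => s * x ^ P with hg
  have hit : ∀ n y, g^[n] y = s ^ (∑ l ∈ Finset.range n, P ^ l) * y ^ P ^ n := by
    intro n y
    induction n with
    | zero => simp
    | succ n ih =>
      rw [Function.iterate_succ_apply', ih]
      simp only [hg]
      rw [Finset.sum_range_succ', mul_pow, ← pow_mul, ← pow_mul, Finset.sum_mul, pow_add]
      simp_rw [← pow_succ]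
      ring
  obtain ⟨u₀, hu₀⟩ := hs
  have hu₀0 : u₀ ≠ 0 := by rintro rfl; exact hs0 (by rw [hu₀, zero_mul])
  -- A norm of the square root u₀ of s: the product of its conjugates u₀^(P^l) for l < f. It is
  -- fixed by y ↦ y^P, hence lies in the subfield of order r = 2h + 1, and the f-th iterate of g is
  -- multiplication by u².
  set u := u₀ ^ (∑ l ∈ Finset.range f, P ^ l) with hu
  have hu0 : u ≠ 0 := pow_ne_zero _ hu₀0
  have huP : u ^ P = u := by
    apply mul_right_cancel₀ hu₀0
    rw [hu, ← pow_mul, Finset.sum_mul]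
    simp_rw [← pow_succ]
    have h2 := Finset.sum_range_succ' (fun l => P ^ l) f
    rw [pow_zero] at h2
    rw [← h2, Finset.sum_range_succ, pow_add, hPf, pow_succ]
  have hur : u ^ (2 * h) = 1 := by
    have h2 := pow_pow_gcd_eq_self hq huP
    rw [← hd, ← hr, hh, pow_succ] at h2
    exact mul_right_cancel₀ hu0 (by rw [h2, one_mul])
  have hgf : ∀ y, g^[f] y = u ^ 2 * y := by
    intro y
    rw [hit, hPf, hu₀, mul_pow, hu, sq]
  have hgL : ∀ y, g^[f * h] y = y := by
    intro y
    have h2 : ∀ n, (g^[f])^[n] y = (u ^ 2) ^ n * y := by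
      intro n
      induction n with
      | zero => simp
      | succ n ih => rw [Function.iterate_succ_apply', ih, hgf, pow_succ]; ring
    rw [Function.iterate_mul, h2, ← pow_mul, hur, one_mul]
  have hL : 0 < f * h := Nat.mul_pos hf0 (by omega)
  have hex : ∀ t : Subgroup.square Fˣ, ∃ k : Fin (f * h), g^[k] 1 = ((t : Fˣ) : F) := by
    intro t
    obtain ⟨r, hr⟩ := Subgroup.mem_square.mp t.2
    obtain ⟨k, hk⟩ := hcyc _ (Units.ne_zero (t : Fˣ)) ⟨r, by rw [hr, Units.val_mul]⟩
    refine ⟨⟨k % (f * h), Nat.mod_lt _ hL⟩, ?_⟩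
    rw [← hk]
    have hper : Function.IsPeriodicPt g (f * h) 1 := hgL 1
    exact hper.iterate_mod_apply k
  choose k hk using hex
  have hkinj : Function.Injective k := by
    intro t t' htt
    have h2 := hk t
    rw [htt, hk t'] at h2
    exact Subtype.ext (Units.ext h2.symm)
  have hcard := Nat.card_le_card_of_injective k hkinj
  rw [card_square_units hF, Nat.card_fin] at hcard
  have hqr : Nat.card F = r ^ f := by rw [hq, hf, hr, pow_mul]
  -- The orbit of 1 has at most f (r - 1) / 2 points but covers all (r^f - 1) / 2 nonzero squares.
  -- Bernoulli's inequality rules this out for f ≥ 2.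
  have hf1 : f = 1 := by
    by_contra hne
    obtain ⟨f', rfl⟩ : ∃ f', f = f' + 2 := ⟨f - 2, by omega⟩
    have hbern : 1 + (f' + 1) * (2 * h) ≤ r ^ (f' + 1) := by
      generalize f' + 1 = n
      induction n with
      | zero => simp
      | succ n ih =>
        rw [pow_succ]
        have h8 := Nat.mul_le_mul_right r ih
        rw [hh] at h8 ⊢
        nlinarith [Nat.zero_le (n * h * h)]
    have h5 : r * (1 + (f' + 1) * (2 * h)) ≤ r ^ (f' + 2) := by
      rw [pow_succ' r (f' + 1)]
      exact Nat.mul_le_mul_left _ hbern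
    have hh1 : 1 ≤ h := by omega
    rw [hqr] at hcard h1
    have h6 : r ^ (f' + 2) ≤ 2 * ((f' + 2) * h) + 1 := by omega
    have h7 := h5.trans h6
    rw [hh] at h7
    nlinarith [Nat.mul_le_mul hh1 hh1, Nat.zero_le (f' * h), Nat.zero_le (f' * h * h)]
  exact pow_pow_eq_self_of_dvd hq ⟨i, by rw [hi, hf, hf1, mul_one]⟩ x

end PaleyAutomorphisms


/-! ### Rotations of the Paley graph with arc-transitive symmetry -/

section PaleyMaps

variable {F : Type*} [Field F] [Finite F]

theorem paley_pow_fst {hF : Nat.card F % 4 = 1} {R : Equiv.Perm (paleyGraph F hF).Dart}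
    (hR : ∀ d, (R d).fst = d.fst) (k : ℕ) (d : (paleyGraph F hF).Dart) :
    ((R ^ k) d).fst = d.fst := by
  induction k with
  | zero => rfl
  | succ k ih => rw [pow_succ', Equiv.Perm.mul_apply, hR, ih]

theorem Equiv.map_pow_apply {X Y : Type*} {R : Equiv.Perm X} {R' : Equiv.Perm Y} (T : X → Y)
    (h : ∀ d, T (R d) = R' (T d)) (k : ℕ) (d : X) : T ((R ^ k) d) = (R' ^ k) (T d) := by
  induction k with
  | zero => rfl
  | succ k ih => rw [pow_succ', pow_succ', Equiv.Perm.mul_apply, Equiv.Perm.mul_apply, h, ih]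

/-- The dart from `v` to `v + 1`. -/
def paleyDart (hF : Nat.card F % 4 = 1) (v : F) : (paleyGraph F hF).Dart :=
  ⟨(v, v + 1), (paleyGraph_adj_add_iff hF).mpr ⟨one_ne_zero, IsSquare.one⟩⟩

/-- The darts at a vertex form one orbit of R, so the image of the tail depends only on the tail;
reversal carries this over to heads. -/
theorem exists_vertex_map {hF : Nat.card F % 4 = 1} {R R' : Equiv.Perm (paleyGraph F hF).Dart}
    (htrans : ∀ d d', d.fst = d'.fst → ∃ k : ℕ, (R ^ k) d = d') (hR' : ∀ d, (R' d).fst = d.fst)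
    (T : (paleyGraph F hF).Dart → (paleyGraph F hF).Dart) (hrot : ∀ d, T (R d) = R' (T d))
    (hrev : ∀ d, T d.symm = (T d).symm) :
    ∃ α : F → F, ∀ d, (T d).fst = α d.fst ∧ (T d).snd = α d.snd := by
  have hfst : ∀ d, (T d).fst = (T (paleyDart hF d.fst)).fst := by
    intro d
    obtain ⟨k, hk⟩ := htrans (paleyDart hF d.fst) d rfl
    nth_rewrite 1 [← hk]
    rw [Equiv.map_pow_apply T hrot, paley_pow_fst hR']
  refine ⟨fun v => (T (paleyDart hF v)).fst, fun d => ⟨hfst d, ?_⟩⟩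
  have h := hfst d.symm
  rw [hrev] at h
  exact h

/-- A bijection between darts which commutes with rotations and reversals comes from an
automorphism of the Paley graph. -/
theorem exists_affine_of_dart_equiv {p e : ℕ} (hp : p.Prime) (hq : Nat.card F = p ^ e)
    {hF : Nat.card F % 4 = 1} {R R' : Equiv.Perm (paleyGraph F hF).Dart}
    (htrans : ∀ d d', d.fst = d'.fst → ∃ k : ℕ, (R ^ k) d = d') (hR : ∀ d, (R d).fst = d.fst)
    (htrans' : ∀ d d', d.fst = d'.fst → ∃ k : ℕ, (R' ^ k) d = d') (hR' : ∀ d, (R' d).fst = d.fst)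
    (T : Equiv.Perm (paleyGraph F hF).Dart) (hrot : ∀ d, T (R d) = R' (T d))
    (hrev : ∀ d, T d.symm = (T d).symm) :
    ∃ α : Equiv.Perm F, (∀ d, (T d).fst = α d.fst ∧ (T d).snd = α d.snd) ∧ ∃ k : ℕ,
      ∀ x, α x = α 0 + (α 1 - α 0) * x ^ p ^ k := by
  obtain ⟨α, hα⟩ := exists_vertex_map htrans hR' T hrot hrev
  obtain ⟨β, hβ⟩ := exists_vertex_map htrans' hR T.symm
    (fun d => by rw [Equiv.symm_apply_eq, hrot, Equiv.apply_symm_apply])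
    (fun d => by rw [Equiv.symm_apply_eq, hrev, Equiv.apply_symm_apply])
  have hβα : ∀ v, β (α v) = v := by
    intro v
    have h := (hβ (T (paleyDart hF v))).1
    rw [Equiv.symm_apply_apply, (hα _).1] at h
    exact h.symm
  have hαβ : ∀ v, α (β v) = v := by
    intro v
    have h := (hα (T.symm (paleyDart hF v))).1
    rw [Equiv.apply_symm_apply, (hβ _).1] at h
    exact h.symm
  have hadj : ∀ v w, (paleyGraph F hF).Adj v w → (paleyGraph F hF).Adj (α v) (α w) := by
    intro v w h
    have h1 := (T ⟨(v, w), h⟩).adj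
    rwa [(hα _).1, (hα _).2] at h1
  have hadj' : ∀ v w, (paleyGraph F hF).Adj v w → (paleyGraph F hF).Adj (β v) (β w) := by
    intro v w h
    have h1 := (T.symm ⟨(v, w), h⟩).adj
    rwa [(hβ _).1, (hβ _).2] at h1
  refine ⟨⟨α, β, hβα, hαβ⟩, hα, ?_⟩
  exact paleyGraph_automorphism hp hq hF (α := α)
    (Function.LeftInverse.injective hβα) fun v w => ⟨fun h => by
      have := hadj' _ _ h
      rwa [hβα, hβα] at this, hadj v w⟩

/-- Every element is a difference of two squares, and -1 is a square. -/
theorem paley_eq_add_isSquare (hF : Nat.card F % 4 = 1) (y : F) :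
    ∃ a b : F, IsSquare a ∧ IsSquare b ∧ y = a + b := by
  have h2 : (2 : F) ≠ 0 := Ring.two_ne_zero (ringChar_ne_two_of_card_mod_four hF)
  refine ⟨((y + 1) / 2) * ((y + 1) / 2), -1 * (((y - 1) / 2) * ((y - 1) / 2)), ⟨_, rfl⟩,
    (paley_isSquare_neg_one F hF).mul ⟨_, rfl⟩, ?_⟩
  field_simp
  ring

theorem PaleyGenerator.val_ne_one (hF : Nat.card F % 4 = 1) (s : PaleyGenerator F) :
    ((s.1 : Fˣ) : F) ≠ 1 := by
  have h1 := Finite.one_lt_card (α := F)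
  intro h
  have h2 := (zpowers_eq_square_iff hF s.1).mp s.2
  rw [Units.ext (u := s.1) (v := 1) h, orderOf_one] at h2
  omega

theorem PaleyGenerator.exists_pow_eq (s : PaleyGenerator F) {t : F} (ht0 : t ≠ 0)
    (ht : IsSquare t) : ∃ k : ℕ, ((s.1 : Fˣ) : F) ^ k = t := by
  obtain ⟨r, rfl⟩ := ht
  have hr : r ≠ 0 := by rintro rfl; simp at ht0
  have hmem : Units.mk0 r hr * Units.mk0 r hr ∈ Subgroup.zpowers s.1 := by
    rw [s.2, Subgroup.mem_square]
    exact ⟨_, rfl⟩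
  rw [← mem_powers_iff_mem_zpowers] at hmem
  obtain ⟨k, hk⟩ := hmem
  refine ⟨k, ?_⟩
  have := congrArg (fun u : Fˣ => (u : F)) hk
  simpa using this

/-- An arc-transitive rotation of the Paley graph is the rotation of a Paley map. -/
theorem exists_eq_paleyRot {p e : ℕ} (hp : p.Prime) (hq : Nat.card F = p ^ e)
    {hF : Nat.card F % 4 = 1} {R : Equiv.Perm (paleyGraph F hF).Dart}
    (htrans : ∀ d d', d.fst = d'.fst → ∃ k : ℕ, (R ^ k) d = d') (hR : ∀ d, (R d).fst = d.fst)
    (hreg : ∀ d d', ∃ T : Equiv.Perm (paleyGraph F hF).Dart, (∀ d, T (R d) = R (T d)) ∧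
      (∀ d, T d.symm = (T d).symm) ∧ T d = d') :
    ∃ s : PaleyGenerator F, R = paleyRot hF s := by
  have := Fact.mk hp
  have := Fintype.ofFinite F
  have := charP_of_card_eq_prime_pow (Nat.card_eq_fintype_card (α := F) ▸ hq)
  have auto := fun T h1 h2 =>
    exists_affine_of_dart_equiv hp hq htrans hR htrans hR T h1 h2
  obtain ⟨T₀, hT₀, hT₀', hT₀d⟩ := hreg (paleyDart hF 0) (R (paleyDart hF 0))
  obtain ⟨α, hα, j, hαj⟩ := auto T₀ hT₀ hT₀'
  have hα0 : α 0 = 0 := by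
    have h := (hα (paleyDart hF 0)).1
    rw [hT₀d, hR] at h
    exact h.symm
  simp only [hα0, zero_add, sub_zero] at hαj
  set s := α 1 with hs
  -- T₀ commutes with R and agrees with it on one dart at 0, hence on its whole R-orbit.
  have hRα : ∀ d, d.fst = 0 → R d = T₀ d := by
    intro d hd
    obtain ⟨k, rfl⟩ := htrans (paleyDart hF 0) d hd.symm
    rw [Equiv.map_pow_apply T₀ hT₀, hT₀d, ← Equiv.Perm.mul_apply, ← Equiv.Perm.mul_apply,
      ← pow_succ, ← pow_succ']
  have hR0 : ∀ d, d.fst = 0 → (R d).snd = s * d.snd ^ p ^ j := by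
    intro d hd
    rw [hRα d hd, (hα d).2, hαj]
  have hsq : s ≠ 0 ∧ IsSquare s := by
    have h := (T₀ (paleyDart hF 0)).adj
    rw [(hα _).1, (hα _).2] at h
    change (paleyGraph F hF).Adj (α 0) (α (0 + 1)) at h
    rw [hα0, zero_add, ← hs] at h
    have h2 := (paleyGraph_adj_add_iff hF (v := 0) (y := s)).mp (by rwa [zero_add])
    exact h2
  have hit : ∀ k : ℕ, ((R ^ k) (paleyDart hF 0)).snd = (fun x => s * x ^ p ^ j)^[k] 1 := by
    intro k
    induction k with
    | zero => change (0 : F) + 1 = 1; rw [zero_add]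
    | succ k ih =>
      rw [pow_succ', Equiv.Perm.mul_apply, hR0 _ (paley_pow_fst hR k _), ih,
        Function.iterate_succ_apply']
  have hcyc : ∀ t : F, t ≠ 0 → IsSquare t → ∃ k : ℕ, (fun x => s * x ^ p ^ j)^[k] 1 = t := by
    intro t ht0 ht
    obtain ⟨k, hk⟩ := htrans (paleyDart hF 0)
      ⟨(0, 0 + t), (paleyGraph_adj_add_iff hF).mpr ⟨ht0, ht⟩⟩ rfl
    refine ⟨k, ?_⟩
    rw [← hit, hk]
    exact zero_add t
  have htriv : ∀ x : F, x ^ p ^ j = x := pow_pow_eq_self_of_cycle hp hq hF hsq.1 hsq.2 hcyc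
  simp only [htriv] at hcyc hR0 hαj
  have hpow : ∀ k : ℕ, (fun x => s * x)^[k] 1 = s ^ k := by
    intro k
    induction k with
    | zero => simp
    | succ k ih => rw [Function.iterate_succ_apply', ih, pow_succ']
  have hgen : Subgroup.zpowers (Units.mk0 s hsq.1) = Subgroup.square Fˣ := by
    apply le_antisymm
    · rw [Subgroup.zpowers_le, Subgroup.mem_square]
      obtain ⟨r, hr⟩ := hsq.2
      have hr0 : r ≠ 0 := by rintro rfl; exact hsq.1 (by rw [hr, zero_mul])
      exact ⟨Units.mk0 r hr0, Units.ext hr⟩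
    · intro t ht
      obtain ⟨r, hr⟩ := Subgroup.mem_square.mp ht
      obtain ⟨k, hk⟩ := hcyc t t.ne_zero ⟨r, by rw [hr, Units.val_mul]⟩
      rw [hpow] at hk
      exact Subgroup.mem_zpowers_iff.mpr ⟨k, Units.ext (by simpa using hk)⟩
  let S : PaleyGenerator F := ⟨Units.mk0 s hsq.1, hgen⟩
  have hv : ∀ v : F, ∃ T : Equiv.Perm (paleyGraph F hF).Dart, ∃ α : Equiv.Perm F, ∃ k : ℕ,
      (∀ d, T (R d) = R (T d)) ∧ (∀ d, (T d).fst = α d.fst ∧ (T d).snd = α d.snd) ∧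
      ∀ x, α x = v + x ^ p ^ k := by
    intro v
    obtain ⟨T, hT, hT', hTd⟩ := hreg (paleyDart hF 0) (paleyDart hF v)
    obtain ⟨β, hβ, k, hβk⟩ := auto T hT hT'
    have h := hβ (paleyDart hF 0)
    rw [hTd] at h
    have h1 : v = β 0 := h.1
    have h2 : v + 1 = β (0 + 1) := h.2
    rw [zero_add] at h2
    refine ⟨T, β, k, hT, hβ, fun x => ?_⟩
    rw [hβk x, ← h1, ← h2]
    ring
  -- Conjugating the rotation at 0 by an automorphism x ↦ v + x^(p^k) replaces the multiplier s by
  -- s^(p^k).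
  have hσ : ∀ v : F, ∃ c : F, ∀ d, d.fst = v → (R d).snd = v + c * (d.snd - v) := by
    intro v
    obtain ⟨T, β, k, hT, hβ, hβk⟩ := hv v
    refine ⟨s ^ p ^ k, fun d hd => ?_⟩
    obtain ⟨d, rfl⟩ := T.surjective d
    have hp0 : p ^ k ≠ 0 := pow_ne_zero _ hp.ne_zero
    have hd0 : d.fst = 0 := by
      rw [(hβ d).1] at hd
      apply β.injective
      rw [hd, hβk, zero_pow hp0, add_zero]
    rw [← hT, (hβ _).2, (hβ _).2, hR0 d hd0, hβk, hβk, mul_pow]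
    ring
  choose σ hσ using hσ
  have hσ0 : σ 0 = s := by
    have h1 := hσ 0 (paleyDart hF 0) rfl
    have h2 := hR0 (paleyDart hF 0) rfl
    change _ = s * ((0 : F) + 1) at h2
    change _ = 0 + σ 0 * ((0 : F) + 1 - 0) at h1
    rw [h2] at h1
    simpa using h1.symm
  have hσauto : ∀ (T : Equiv.Perm (paleyGraph F hF).Dart) (β : Equiv.Perm F) (a b : F) (k : ℕ),
      (∀ d, T (R d) = R (T d)) → (∀ d, (T d).fst = β d.fst ∧ (T d).snd = β d.snd) → a ≠ 0 →
      (∀ x, β x = b + a * x ^ p ^ k) → ∀ v, σ (β v) = σ v ^ p ^ k := by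
    intro T β a b k hT hβ ha hβk v
    have h1 := congrArg (fun d => d.snd) (hT (paleyDart hF v))
    rw [(hβ _).2, hσ v _ rfl, hσ (β v) _ (hβ _).1, (hβ _).2] at h1
    change β (v + σ v * (v + 1 - v)) = β v + σ (β v) * (β (v + 1) - β v) at h1
    rw [add_sub_cancel_left, mul_one, hβk (v + σ v), hβk (v + 1), add_pow_char_pow,
      add_pow_char_pow, one_pow] at h1
    have h2 := hβk v
    apply mul_left_cancel₀ ha
    linear_combination -h1 - (1 - σ (β v)) * h2
  have hσs : ∀ v, σ (s * v) = σ v := by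
    intro v
    have h := hσauto T₀ α s 0 j hT₀ hα hsq.1 (fun x => by rw [hαj, htriv, zero_add]) v
    rwa [hαj, htriv] at h
  have hσt : ∀ t : F, t ≠ 0 → IsSquare t → ∀ v, σ (t * v) = σ v := by
    intro t ht0 ht v
    obtain ⟨k, rfl⟩ := S.exists_pow_eq ht0 ht
    change σ (s ^ k * v) = σ v
    clear ht0 ht
    induction k with
    | zero => simp
    | succ k ih => rw [pow_succ', mul_assoc, hσs, ih]
  obtain ⟨T, β, k, hT, hβ, hβk⟩ := hv 1
  have hβσ := hσauto T β 1 1 k hT hβ one_ne_zero (fun x => by rw [hβk, one_mul])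
  set c := s ^ p ^ k with hc
  have hc0 : c ≠ 0 := pow_ne_zero _ hsq.1
  have hc1 : c ≠ 1 := by
    intro h
    have : β s = β 1 := by rw [hβk, hβk, ← hc, h, one_pow]
    exact S.val_ne_one hF (β.injective this)
  -- Chosen so that β(s y) = c (β y + w). Since σ is the same at y and s y, it is the same at β y
  -- and β(s y); as c is a square, w is then a period of σ. Scaling by squares makes every square
  -- multiple of w a period, and sums of two of these exhaust F.
  set w := c⁻¹ - 1 with hw
  have hw0 : w ≠ 0 := by
    rw [hw, sub_ne_zero]
    exact inv_ne_one.mpr hc1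
  have hσw : ∀ x, σ (x + w) = σ x := by
    intro x
    obtain ⟨y, rfl⟩ := β.surjective x
    rw [← hσt c hc0 (hsq.2.pow _), show c * (β y + w) = β (s * y) by
      rw [hβk, hβk, hw, mul_pow, ← hc]; field_simp; ring, hβσ, hβσ, hσs]
  have hσtw : ∀ t : F, IsSquare t → ∀ x, σ (x + t * w) = σ x := by
    intro t ht x
    by_cases ht0 : t = 0
    · rw [ht0, zero_mul, add_zero]
    · rw [show x + t * w = t * (t⁻¹ * x + w) by field_simp, hσt t ht0 ht, hσw,
        hσt _ (inv_ne_zero ht0) ht.inv]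
  have hσconst : ∀ v, σ v = s := by
    intro v
    obtain ⟨a, b, ha, hb, hab⟩ := paley_eq_add_isSquare hF (v / w)
    rw [show v = 0 + a * w + b * w by rw [zero_add, ← add_mul, ← hab, div_mul_cancel₀ _ hw0],
      hσtw b hb, hσtw a ha, hσ0]
  refine ⟨S, Equiv.ext fun d => SimpleGraph.Dart.ext _ _ (Prod.ext (hR d) ?_)⟩
  change (R d).snd = d.fst + s * (d.snd - d.fst)
  rw [hσ d.fst d rfl, hσconst]

end PaleyMaps


/-! ### Classification and enumeration of the Paley maps -/

section PaleyClassification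

variable {F : Type u} [Field F] [Finite F]

theorem OrientedMap.tail_eq_iff (M : OrientedMap.{v}) (d d' : M.Dart) :
    M.tail d = M.tail d' ↔ ∃ k : ℕ, (M.rot ^ k) d = d' := by
  constructor
  · intro h
    classical
    have := Fintype.ofFinite M.Dart
    have h1 : M.rot.SameCycle d d' := Quotient.exact h
    obtain ⟨k, -, -, hk⟩ := h1.exists_pow_eq''
    exact ⟨k, hk⟩
  · rintro ⟨k, hk⟩
    exact Quotient.sound ⟨k, by simpa using hk⟩

theorem OrientedMap.IsOrientablyRegular.of_iso {M : OrientedMap.{v}} {N : OrientedMap.{u}}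
    (f : M.Iso N) (h : N.IsOrientablyRegular) : M.IsOrientablyRegular := by
  intro d d'
  obtain ⟨g, hg⟩ := h (f.toEquiv d) (f.toEquiv d')
  refine ⟨⟨(f.toEquiv.trans g.toEquiv).trans f.toEquiv.symm, fun x => ?_, fun x => ?_⟩, ?_⟩
  · simp only [Equiv.trans_apply, Equiv.symm_apply_eq, f.map_rot, g.map_rot,
      Equiv.apply_symm_apply]
  · simp only [Equiv.trans_apply, Equiv.symm_apply_eq, f.map_rev, g.map_rev,
      Equiv.apply_symm_apply]
  · simp only [Equiv.trans_apply, Equiv.symm_apply_eq, hg]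

/-- A bijection between the darts which commutes with the rotations and reversals is an
isomorphism of Paley maps. -/
theorem exists_iso_paleyMap_of_injective {hF : Nat.card F % 4 = 1} {s t : PaleyGenerator F}
    (T : (paleyGraph F hF).Dart → (paleyGraph F hF).Dart) (hT : Function.Injective T)
    (hrot : ∀ d, T (paleyRot hF s d) = paleyRot hF t (T d))
    (hrev : ∀ d, T d.symm = (T d).symm) :
    ∃ f : OrientedMap.Iso (paleyMap hF s) (paleyMap hF t), ∀ d, f.toEquiv d = T d :=
  have : Finite (paleyGraph F hF).Dart := (paleyMap hF s).finite
  ⟨⟨Equiv.ofBijective T (Finite.injective_iff_bijective.mp hT), hrot, hrev⟩, fun _ => rfl⟩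

theorem paleyMap_isOrientablyRegular (hF : Nat.card F % 4 = 1) (s : PaleyGenerator F) :
    (paleyMap hF s).IsOrientablyRegular := by
  intro (d : (paleyGraph F hF).Dart) (d' : (paleyGraph F hF).Dart)
  set t := (d'.snd - d'.fst) / (d.snd - d.fst) with ht
  have hd := d.symm.adj
  have hd' := d'.symm.adj
  have hd0 : d.snd - d.fst ≠ 0 := hd.1
  have ht0 : t ≠ 0 := div_ne_zero hd'.1 hd0
  have hts : IsSquare t := IsSquare.div hd'.2 hd.2
  -- The affine map carrying d to d'; its slope t is a quotient of two nonzero squares.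
  let T : (paleyGraph F hF).Dart → (paleyGraph F hF).Dart := fun x =>
    ⟨(d'.fst + t * (x.fst - d.fst), d'.fst + t * (x.snd - d.fst)),
      paleyGraph_adj_affine hF ht0 hts _ _ x.adj⟩
  have hT : Function.Injective T := by
    intro x y hxy
    have h1 : d'.fst + t * (x.fst - d.fst) = d'.fst + t * (y.fst - d.fst) :=
      congrArg (fun z => z.fst) hxy
    have h2 : d'.fst + t * (x.snd - d.fst) = d'.fst + t * (y.snd - d.fst) :=
      congrArg (fun z => z.snd) hxy
    exact SimpleGraph.Dart.ext _ _ (Prod.ext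
      (sub_left_injective (mul_left_cancel₀ ht0 (add_left_cancel h1)))
      (sub_left_injective (mul_left_cancel₀ ht0 (add_left_cancel h2))))
  have hrot : ∀ x, T (paleyRot hF s x) = paleyRot hF s (T x) := by
    intro x
    refine SimpleGraph.Dart.ext _ _ (Prod.ext rfl ?_)
    change d'.fst + t * ((x.fst + (s.1 : F) * (x.snd - x.fst)) - d.fst)
      = (d'.fst + t * (x.fst - d.fst)) + (s.1 : F) *
        ((d'.fst + t * (x.snd - d.fst)) - (d'.fst + t * (x.fst - d.fst)))
    ring
  obtain ⟨f, hf⟩ := exists_iso_paleyMap_of_injective T hT hrot fun x => rfl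
  refine ⟨f, (hf d).trans (SimpleGraph.Dart.ext _ _ (Prod.ext ?_ ?_))⟩
  · change d'.fst + t * (d.fst - d.fst) = d'.fst
    ring
  · change d'.fst + t * (d.snd - d.fst) = d'.snd
    rw [ht, div_mul_cancel₀ _ hd0]
    ring

theorem isEmbeddingOf_of_iso_paleyMap {hF : Nat.card F % 4 = 1} {s : PaleyGenerator F}
    {M : OrientedMap.{v}} (f : M.Iso (paleyMap hF s)) : M.IsEmbeddingOf (paleyGraph F hF) := by
  let ψ : M.Dart ≃ (paleyGraph F hF).Dart := f.toEquiv
  have hrot : ∀ d, ψ (M.rot d) = paleyRot hF s (ψ d) := f.map_rot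
  have htail : ∀ d d', M.tail d = M.tail d' ↔ (ψ d).fst = (ψ d').fst := by
    intro d d'
    rw [M.tail_eq_iff]
    constructor
    · rintro ⟨k, rfl⟩
      rw [Equiv.map_pow_apply ψ hrot, (paleyRot_pow hF s k _).1]
    · intro h
      obtain ⟨k, hk⟩ := paleyRot_transitive hF s _ _ h
      exact ⟨k, ψ.injective (by rw [Equiv.map_pow_apply ψ hrot, hk])⟩
  let φ : M.Vertex → F := Quotient.lift (fun d => (ψ d).fst) fun d d' h =>
    (htail d d').mp (Quotient.sound h)
  have hφ : Function.Bijective φ := by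
    constructor
    · intro a b
      induction a using Quotient.ind
      induction b using Quotient.ind
      exact (htail _ _).mpr
    · intro v
      refine ⟨M.tail (ψ.symm (paleyDart hF v)), ?_⟩
      change (ψ (ψ.symm (paleyDart hF v))).fst = v
      rw [Equiv.apply_symm_apply]
      rfl
  exact ⟨Equiv.ofBijective φ hφ, ψ, fun d => rfl, f.map_rev⟩

theorem exists_iso_paleyMap {p e : ℕ} (hp : p.Prime) (hq : Nat.card F = p ^ e)
    {hF : Nat.card F % 4 = 1} {M : OrientedMap.{v}} (hM : M.IsEmbeddingOf (paleyGraph F hF))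
    (hreg : M.IsOrientablyRegular) :
    ∃ s : PaleyGenerator F, Nonempty (OrientedMap.Iso M (paleyMap hF s)) := by
  obtain ⟨φ, ψ, hfst, hrev⟩ := hM
  have htail : ∀ d d', (ψ d).fst = (ψ d').fst ↔ ∃ k : ℕ, (M.rot ^ k) d = d' := by
    intro d d'
    rw [hfst, hfst, φ.injective.eq_iff, M.tail_eq_iff]
  let R : Equiv.Perm (paleyGraph F hF).Dart := (ψ.symm.trans M.rot).trans ψ
  have hR : ∀ d, ψ (M.rot d) = R (ψ d) := fun d => by simp [R]
  obtain ⟨s, hs⟩ := exists_eq_paleyRot hp hq (R := R)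
    (fun d d' h => by
      obtain ⟨k, hk⟩ := (htail (ψ.symm d) (ψ.symm d')).mp (by simpa using h)
      refine ⟨k, ?_⟩
      have := Equiv.map_pow_apply ψ hR k (ψ.symm d)
      rw [hk] at this
      simpa using this.symm)
    (fun d => by
      obtain ⟨d, rfl⟩ := ψ.surjective d
      rw [← hR]
      exact ((htail d (M.rot d)).mpr ⟨1, by simp⟩).symm)
    (fun d d' => by
      obtain ⟨g, hg⟩ := hreg (ψ.symm d) (ψ.symm d')
      refine ⟨(ψ.symm.trans g.toEquiv).trans ψ, fun x => ?_, fun x => ?_, ?_⟩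
      · simp [R, g.map_rot]
      · obtain ⟨x, rfl⟩ := ψ.surjective x
        simp [← hrev, g.map_rev]
      · simp [hg])
  refine ⟨s, ⟨⟨ψ, fun d => ?_, hrev⟩⟩⟩
  exact (hR d).trans (by rw [hs]; rfl)

/-- An isomorphism is induced by some x ↦ b + a x^(p^k); following the dart after (0, 1) shows that
the affine part leaves the generator alone and the Frobenius part raises it to the power p^k. -/
theorem paleyMap_iso_iff {p e : ℕ} (hp : p.Prime) (hq : Nat.card F = p ^ e)
    (hF : Nat.card F % 4 = 1) (s t : PaleyGenerator F) :
    Nonempty (OrientedMap.Iso (paleyMap hF s) (paleyMap hF t)) ↔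
      ∃ k : ℕ, ((t.1 : Fˣ) : F) = ((s.1 : Fˣ) : F) ^ p ^ k := by
  have := Fact.mk hp
  have := Fintype.ofFinite F
  have := charP_of_card_eq_prime_pow (Nat.card_eq_fintype_card (α := F) ▸ hq)
  constructor
  · rintro ⟨f⟩
    let T : Equiv.Perm (paleyGraph F hF).Dart := f.toEquiv
    obtain ⟨α, hα, k, hk⟩ := exists_affine_of_dart_equiv hp hq (paleyRot_transitive hF s)
      (fun _ => rfl) (paleyRot_transitive hF t) (fun _ => rfl) T f.map_rot f.map_rev
    refine ⟨k, ?_⟩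
    have h : (T (paleyRot hF s (paleyDart hF 0))).snd
      = (paleyRot hF t (T (paleyDart hF 0))).snd :=
      congrArg (fun d : (paleyGraph F hF).Dart => d.snd) (f.map_rot (paleyDart hF 0))
    have h1 := hα (paleyDart hF 0)
    have h2 : (paleyRot hF t (T (paleyDart hF 0))).snd =
      (T (paleyDart hF 0)).fst + (t.1 : F) *
      ((T (paleyDart hF 0)).snd
        - (T (paleyDart hF 0)).fst) := rfl
    rw [(hα _).2, h2, h1.1, h1.2] at h
    change α (0 + (s.1 : F) * (0 + 1 - 0)) = α 0 + (t.1 : F) * (α (0 + 1) - α 0) at h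
    rw [zero_add, zero_add, sub_zero, mul_one, hk (s.1 : F)] at h
    have hne : α 1 - α 0 ≠ 0 := sub_ne_zero.mpr (α.injective.ne one_ne_zero)
    apply mul_left_cancel₀ hne
    linear_combination -h
  · rintro ⟨k, hk⟩
    have hadj : ∀ v w, (paleyGraph F hF).Adj v w →
        (paleyGraph F hF).Adj (v ^ p ^ k) (w ^ p ^ k) := by
      rintro v w ⟨h0, hs⟩
      rw [paleyGraph]
      dsimp only
      rw [← sub_pow_char_pow]
      exact ⟨pow_ne_zero _ h0, hs.pow _⟩
    let T : (paleyGraph F hF).Dart → (paleyGraph F hF).Dart := fun x =>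
      ⟨(x.fst ^ p ^ k, x.snd ^ p ^ k), hadj _ _ x.adj⟩
    have hinj : Function.Injective (fun x : F => x ^ p ^ k) := iterateFrobenius_inj F p k
    have hT : Function.Injective T := fun x y hxy =>
      SimpleGraph.Dart.ext _ _ (Prod.ext (hinj (congrArg (fun z => z.fst) hxy))
        (hinj (congrArg (fun z => z.snd) hxy)))
    have hrot : ∀ x, T (paleyRot hF s x) = paleyRot hF t (T x) := by
      intro x
      refine SimpleGraph.Dart.ext _ _ (Prod.ext rfl ?_)
      change (x.fst + (s.1 : F) * (x.snd - x.fst)) ^ p ^ k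
        = x.fst ^ p ^ k + (t.1 : F) * (x.snd ^ p ^ k - x.fst ^ p ^ k)
      rw [hk, add_pow_char_pow, mul_pow, sub_pow_char_pow]
    obtain ⟨f, -⟩ := exists_iso_paleyMap_of_injective T hT hrot fun x => rfl
    exact ⟨f⟩

/-- The image of a generator of the group of squares under a power of the Frobenius map. -/
def PaleyGenerator.frobeniusPow {p e : ℕ} (hp : p.Prime) (hq : Nat.card F = p ^ e)
    (hF : Nat.card F % 4 = 1) (s : PaleyGenerator F) (k : ℕ) : PaleyGenerator F :=
  ⟨s.1 ^ p ^ k, by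
    rw [zpowers_eq_square_iff hF]
    have h := (zpowers_eq_square_iff hF s.1).mp s.2
    rw [Nat.Coprime.orderOf_pow, h]
    rw [h]
    apply Nat.Coprime.pow_right
    rw [Nat.coprime_comm, hp.coprime_iff_not_dvd]
    intro hd
    have he := (exponent_pos_of_card hq).ne'
    have h2 : p ∣ Nat.card F := hq ▸ dvd_pow_self p he
    have h3 : p ∣ 2 * (Nat.card F / 2) + 1 := by
      rwa [show 2 * (Nat.card F / 2) + 1 = Nat.card F by omega]
    have h4 : p ∣ 1 := (Nat.dvd_add_right (hd.mul_left 2)).mp h3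
    exact hp.one_lt.ne' (Nat.dvd_one.mp h4)⟩

/-- Frobenius orbits on generators have full length e: otherwise (q - 1) / 2 would divide p^i - 1
with 0 < i < e, too small since p^i ≤ q / 3. -/
theorem PaleyGenerator.eq_zero_of_pow_pow_eq {p e : ℕ} (hp : p.Prime) (hq : Nat.card F = p ^ e)
    (hF : Nat.card F % 4 = 1) (s : PaleyGenerator F) {i : ℕ} (hi : i < e)
    (h : ((s.1 : Fˣ) : F) ^ p ^ i = s.1) : i = 0 := by
  by_contra hi0
  have hp3 : 3 ≤ p := by
    have := hp.two_le
    have := char_ne_two_of_card hq hF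
    omega
  have hpos := pow_pos hp.pos i
  have h1 : s.1 ^ (p ^ i - 1) = 1 := by
    apply mul_right_cancel (b := s.1)
    rw [← pow_succ, Nat.sub_add_cancel hpos, one_mul]
    exact Units.ext (by simpa using h)
  have h2 := orderOf_dvd_of_pow_eq_one h1
  rw [(zpowers_eq_square_iff hF s.1).mp s.2] at h2
  have h3 : 1 < p ^ i := Nat.one_lt_pow hi0 hp.one_lt
  have h4 := Nat.le_of_dvd (by omega) h2
  have h5 : p * p ^ i ≤ Nat.card F := by
    rw [hq, ← pow_succ']
    exact Nat.pow_le_pow_right hp.pos hi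
  have h6 := Nat.mul_le_mul_right (p ^ i) hp3
  omega

theorem card_quotient_paleyIsoSetoid_mul {p e : ℕ} (hp : p.Prime) (hq : Nat.card F = p ^ e)
    (hF : Nat.card F % 4 = 1) :
    Nat.card (Quotient (paleyIsoSetoid hF)) * e = Nat.totient (Nat.card F / 2) := by
  have := Fact.mk hp
  have := Fintype.ofFinite F
  have := charP_of_card_eq_prime_pow (Nat.card_eq_fintype_card (α := F) ▸ hq)
  -- A class representative and a Frobenius exponent modulo e determine a generator uniquely, so the
  -- classes split the generators into blocks of size e.
  let Φ : Quotient (paleyIsoSetoid hF) × Fin e → PaleyGenerator F := fun x =>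
    x.1.out.frobeniusPow hp hq hF x.2
  have hΦ : ∀ x, Quotient.mk (paleyIsoSetoid hF) (Φ x) = x.1 := by
    intro x
    refine (Quotient.sound ((paleyIsoSetoid hF).symm ?_)).trans (Quotient.out_eq x.1)
    exact (paleyMap_iso_iff hp hq hF _ _).mpr ⟨x.2, by simp [Φ, PaleyGenerator.frobeniusPow]⟩
  have hval : ∀ (s : PaleyGenerator F) (i j : ℕ), i ≤ j → j < e →
      s.frobeniusPow hp hq hF i = s.frobeniusPow hp hq hF j → i = j := by
    intro s i j hij hj h
    have h1 : s.1 ^ p ^ i = s.1 ^ p ^ j := congrArg Subtype.val h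
    have h2 : ((s.1 : Fˣ) : F) ^ p ^ i = ((s.1 : Fˣ) : F) ^ p ^ j := by
      simpa using congrArg Units.val h1
    have h3 : (((s.1 : Fˣ) : F) ^ p ^ (j - i)) ^ p ^ i = ((s.1 : Fˣ) : F) ^ p ^ i := by
      rw [h2, ← pow_mul, ← pow_add, Nat.sub_add_cancel hij]
    have h4 := s.eq_zero_of_pow_pow_eq hp hq hF (by omega) (iterateFrobenius_inj F p i h3)
    omega
  have hbij : Function.Bijective Φ := by
    constructor
    · rintro ⟨Q, i⟩ ⟨Q', j⟩ h
      have hQ : Q = Q' := by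
        have h1 := hΦ (Q, i)
        rw [h, hΦ] at h1
        exact h1.symm
      subst hQ
      refine Prod.ext rfl (Fin.ext ?_)
      rcases le_total (i : ℕ) j with hij | hij
      · exact hval _ _ _ hij j.2 h
      · exact (hval _ _ _ hij i.2 h.symm).symm
    · intro t
      have he := exponent_pos_of_card hq
      have hrel : Nonempty (OrientedMap.Iso
          (paleyMap hF (Quotient.mk (paleyIsoSetoid hF) t).out) (paleyMap hF t)) :=
        Quotient.mk_out (s := paleyIsoSetoid hF) t
      obtain ⟨k, hk⟩ := (paleyMap_iso_iff hp hq hF _ _).mp hrel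
      refine ⟨(Quotient.mk _ t, ⟨k % e, Nat.mod_lt _ he⟩), Subtype.ext (Units.ext ?_)⟩
      rw [hk]
      simp only [Φ, PaleyGenerator.frobeniusPow, Units.val_pow_eq_pow_val]
      nth_rewrite 2 [← Nat.div_add_mod k e]
      rw [pow_add, pow_mul, pow_pow_eq_self_of_dvd hq ⟨_, rfl⟩]
  rw [← card_paleyGenerator hF, ← Nat.card_congr (Equiv.ofBijective Φ hbij), Nat.card_prod,
    Nat.card_fin]

end PaleyClassification

theorem corollary4p4 {F : Type u} [Field F] [Finite F] (p e : ℕ) (hp : p.Prime)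
    (hq : Nat.card F = p ^ e) (hF : Nat.card F % 4 = 1) :
    (∀ M : OrientedMap.{v}, (M.IsEmbeddingOf (paleyGraph F hF) ∧ M.IsOrientablyRegular) ↔
      ∃ s : PaleyGenerator F, Nonempty (OrientedMap.Iso M (paleyMap hF s))) ∧
    e ∣ Nat.totient ((p ^ e - 1) / 2) ∧
    Nat.card (Quotient (paleyIsoSetoid hF)) = Nat.totient ((p ^ e - 1) / 2) / e := by
  have he := exponent_pos_of_card hq
  have hcard := card_quotient_paleyIsoSetoid_mul hp hq hF
  rw [show Nat.card F / 2 = (p ^ e - 1) / 2 by omega] at hcard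
  refine ⟨fun M => ⟨fun h => exists_iso_paleyMap hp hq h.1 h.2, ?_⟩,
    ⟨_, by rw [← hcard, mul_comm]⟩, by rw [← hcard, Nat.mul_div_cancel _ he]⟩
  rintro ⟨s, ⟨f⟩⟩
  exact ⟨isEmbeddingOf_of_iso_paleyMap f,
    OrientedMap.IsOrientablyRegular.of_iso f (paleyMap_isOrientablyRegular hF s)⟩
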